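/- Let $(M,g)$ be a compact connected smooth Riemannian manifold (without boundary) of dimension $n$, let $T$ be a smooth 3-form on $M$ and let $f:M\to\mathbb R$ be a smooth function. Let $\nabla^g$ be the Levi-Civita connection, $Ric^g$ its Ricci tensor and $Scal^g$ its scalar curvature. Let $\delta$ be the codifferential, $(\delta T)_{ij}=-\nabla^g_sT_{sij}$, and put $T^2_{ij}=\sum_{a,b}T_{iab}T_{jab}$ and $\|T\|^2=\sum_{i,a,b}T_{iab}T_{iab}$, where components are taken in an orthonormal frame. The torsion connection is the metric connection $\nabla=\nabla^g+\frac12T$ with totally skew-symmetric torsion $T$, and $Ric$ denotes its Ricci tensor. Suppose that $(M,g,T,f)$ is a generalized (steady) gradient Ricci soliton, that is, $$Ric^g_{ij}=\tfrac14T^2_{ij}-\nabla^g_i\nabla^g_jf,\qquad (\delta T)_{ij}=-\sum_s (df)_s\,T_{sij},\qquad dT=0.$$ Then the following conditions are equivalent: a) the norm of the torsion is constant, $d\|T\|^2=0$; b) the function $f$ is constant; c) the torsion connection is Ricci flat, $Ric=0$; d) the Riemannian scalar curvature $Scal^g$ is constant. In each of these four cases $T$ is harmonic, that is, $dT=0$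 and $\delta T=0$. -/

import Mathlib

open scoped Manifold ContDiff

noncomputable section

namespace SkewTorsion

/-! ### Ricci calculus in local coordinates

In this part `G : E → Matrix` is the matrix `g_{ij}` of a metric in coordinates, `τ i j k` are the
components of a 3-form, `A k i j` are the coefficients of a connection
(`∇_{∂_i} ∂_j = ∑ k, A k i j ∂_k`) and `u` is a function, all given on the model space `ℝⁿ`.
The inverse matrix `(G y)⁻¹` is `g^{ij}`. -/

section Local

/-- The model space `ℝⁿ`. -/
abbrev Coord (n : ℕ) : Type := EuclideanSpace ℝ (Fin n)

variable {n : ℕ}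

/-- The `i`-th coordinate vector of `ℝⁿ`. -/
def basisVec (i : Fin n) : Coord n := EuclideanSpace.single i 1

/-- The partial derivative `∂_i u`. -/
def pd (i : Fin n) (u : Coord n → ℝ) (y : Coord n) : ℝ := fderiv ℝ u y (basisVec i)

/-- The Christoffel symbols `Γ^k_{ij} = ½ g^{kl} (∂_i g_{jl} + ∂_j g_{il} - ∂_l g_{ij})` of the
Levi-Civita connection. -/
def christoffel (G : Coord n → Matrix (Fin n) (Fin n) ℝ) (k i j : Fin n) (y : Coord n) : ℝ :=
  (1 / 2) * ∑ l, (G y)⁻¹ k l *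
    (pd i (fun z => G z j l) y + pd j (fun z => G z i l) y - pd l (fun z => G z i j) y)

/-- The coefficients `Γ^k_{ij} + ½ g^{kl} T_{ijl}` of the metric connection with skew torsion `T`,
that is of `∇ = ∇^g + ½ T`. -/
def torsionCoeff (G : Coord n → Matrix (Fin n) (Fin n) ℝ)
    (τ : Fin n → Fin n → Fin n → Coord n → ℝ) (k i j : Fin n) (y : Coord n) : ℝ :=
  christoffel G k i j y + (1 / 2) * ∑ l, (G y)⁻¹ k l * τ i j l y

/-- The curvature `R(X,Y)Z = [∇_X, ∇_Y] Z - ∇_{[X,Y]} Z` of the connection with coefficients `A`: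
`curvature A l i j k` is the `∂_l`-component of `R(∂_i, ∂_j) ∂_k`. -/
def curvature (A : Fin n → Fin n → Fin n → Coord n → ℝ) (l i j k : Fin n) (y : Coord n) : ℝ :=
  pd i (A l j k) y - pd j (A l i k) y
    + ∑ m, (A l i m y * A m j k y - A l j m y * A m i k y)

/-- The Ricci tensor of a connection: `Ric(Y, Z)` is the trace of `X ↦ R(X, Y) Z`. -/
def ricci (A : Fin n → Fin n → Fin n → Coord n → ℝ) (j k : Fin n) (y : Coord n) : ℝ :=
  ∑ i, curvature A i i j k y

/-- The scalar curvature `g^{ij} Ric^g_{ij}` of the Levi-Civita connection. -/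
def scalarCurvature (G : Coord n → Matrix (Fin n) (Fin n) ℝ) (y : Coord n) : ℝ :=
  ∑ i, ∑ j, (G y)⁻¹ i j * ricci (christoffel G) i j y

/-- The Hessian `∇^g_i ∇^g_j u = ∂_i ∂_j u - Γ^k_{ij} ∂_k u`. -/
def hessian (G : Coord n → Matrix (Fin n) (Fin n) ℝ) (u : Coord n → ℝ) (i j : Fin n)
    (y : Coord n) : ℝ :=
  pd i (pd j u) y - ∑ k, christoffel G k i j y * pd k u y

/-- `T²_{ij} = T_{iab} T_{jab}`, with indices contracted by the metric. -/
def torsionSq (G : Coord n → Matrix (Fin n) (Fin n) ℝ)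
    (τ : Fin n → Fin n → Fin n → Coord n → ℝ) (i j : Fin n) (y : Coord n) : ℝ :=
  ∑ a, ∑ b, ∑ c, ∑ d, (G y)⁻¹ a c * (G y)⁻¹ b d * τ i a b y * τ j c d y

/-- `‖T‖² = T_{iab} T_{iab}`, with indices contracted by the metric. -/
def normSq (G : Coord n → Matrix (Fin n) (Fin n) ℝ)
    (τ : Fin n → Fin n → Fin n → Coord n → ℝ) (y : Coord n) : ℝ :=
  ∑ i, ∑ j, (G y)⁻¹ i j * torsionSq G τ i j y

/-- The Levi-Civita derivative `(∇^g_{∂_s} T)(∂_a, ∂_i, ∂_j)`. -/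
def covDeriv (G : Coord n → Matrix (Fin n) (Fin n) ℝ)
    (τ : Fin n → Fin n → Fin n → Coord n → ℝ) (s a i j : Fin n) (y : Coord n) : ℝ :=
  pd s (τ a i j) y - ∑ m, (christoffel G m s a y * τ m i j y
    + christoffel G m s i y * τ a m j y + christoffel G m s j y * τ a i m y)

/-- The codifferential of a 3-form, `(δT)_{ij} = - g^{sa} ∇^g_s T_{aij}`. -/
def codiff (G : Coord n → Matrix (Fin n) (Fin n) ℝ)
    (τ : Fin n → Fin n → Fin n → Coord n → ℝ) (i j : Fin n) (y : Coord n) : ℝ :=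
  - ∑ s, ∑ a, (G y)⁻¹ s a * covDeriv G τ s a i j y

/-- The interior product `(grad u ⌟ T)_{ij} = g^{st} ∂_t u T_{sij}`. -/
def gradInterior (G : Coord n → Matrix (Fin n) (Fin n) ℝ)
    (τ : Fin n → Fin n → Fin n → Coord n → ℝ) (u : Coord n → ℝ) (i j : Fin n)
    (y : Coord n) : ℝ :=
  ∑ s, ∑ t, (G y)⁻¹ s t * pd t u y * τ s i j y

end Local

/-! ### Tensor fields on a manifold -/

section Global

variable {n : ℕ} {M : Type*} [TopologicalSpace M] [ChartedSpace (Coord n) M]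

/-- A smooth chart of `M`, i.e. a member of the maximal smooth atlas. -/
def IsChart (φ : OpenPartialHomeomorph M (Coord n)) : Prop :=
  φ ∈ IsManifold.maximalAtlas (𝓡 n) ∞ M

variable (n M) in
/-- A (not necessarily smooth) field of alternating 3-forms on the tangent spaces of `M`. -/
abbrev ThreeForm : Type _ := ∀ x : M, TangentSpace (𝓡 n) x [⋀^Fin 3]→L[ℝ] ℝ

/-- The differential of the inverse of a chart. -/
def chartDiff (φ : OpenPartialHomeomorph M (Coord n)) (y : Coord n) :
    Coord n →L[ℝ] TangentSpace (𝓡 n) (φ.symm y) :=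
  mfderiv (𝓡 n) (𝓡 n) φ.symm y

/-- The 3-form `T` in a chart: its pullback to `ℝⁿ` by the inverse of the chart. -/
def localForm (T : ThreeForm n M) (φ : OpenPartialHomeomorph M (Coord n)) (y : Coord n) :
    Coord n [⋀^Fin 3]→L[ℝ] ℝ :=
  (T (φ.symm y)).compContinuousLinearMap (chartDiff φ y)

/-- The components `T_{ijk} = T(∂_i, ∂_j, ∂_k)` in a chart. -/
def components (T : ThreeForm n M) (φ : OpenPartialHomeomorph M (Coord n)) (i j k : Fin n)
    (y : Coord n) : ℝ :=
  localForm T φ y ![basisVec i, basisVec j, basisVec k]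

/-- `T` is a smooth differential form. -/
def IsSmooth (T : ThreeForm n M) : Prop :=
  ∀ φ : OpenPartialHomeomorph M (Coord n), IsChart φ → ContDiffOn ℝ ∞ (localForm T φ) φ.target

/-- `dT = 0`. -/
def IsClosedForm (T : ThreeForm n M) : Prop :=
  ∀ φ : OpenPartialHomeomorph M (Coord n), IsChart φ →
    ∀ y ∈ φ.target, extDeriv (localForm T φ) y = 0

variable [IsManifold (𝓡 n) ∞ M]

variable (n M) in
/-- A smooth Riemannian metric on `M`. -/
abbrev Metric : Type _ :=
  Bundle.ContMDiffRiemannianMetric (𝓡 n) ∞ (Coord n) (fun x : M => TangentSpace (𝓡 n) x)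

/-- The matrix `g_{ij} = g(∂_i, ∂_j)` of the metric in a chart. -/
def localMetric (g : Metric n M) (φ : OpenPartialHomeomorph M (Coord n)) (y : Coord n) :
    Matrix (Fin n) (Fin n) ℝ :=
  Matrix.of fun i j =>
    g.inner (φ.symm y) (chartDiff φ y (basisVec i)) (chartDiff φ y (basisVec j))

/-- `δT = 0`. -/
def IsCoclosedForm (g : Metric n M) (T : ThreeForm n M) : Prop :=
  ∀ φ : OpenPartialHomeomorph M (Coord n), IsChart φ → ∀ y ∈ φ.target, ∀ i j,
    codiff (localMetric g φ) (components T φ) i j y = 0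

/-- `T` is harmonic: `dT = δT = 0`. -/
def IsHarmonic (g : Metric n M) (T : ThreeForm n M) : Prop :=
  IsClosedForm T ∧ IsCoclosedForm g T

/-- `(M, g, T, f)` is a generalized (steady) gradient Ricci soliton:
`Ric^g = ¼ T² - ∇^g ∇^g f`, `δT = - grad f ⌟ T` and `dT = 0`. -/
structure IsGradientSoliton (g : Metric n M) (T : ThreeForm n M) (f : M → ℝ) : Prop where
  ricci_eq : ∀ φ : OpenPartialHomeomorph M (Coord n), IsChart φ → ∀ y ∈ φ.target, ∀ i j,
    ricci (christoffel (localMetric g φ)) i j y =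
      (1 / 4) * torsionSq (localMetric g φ) (components T φ) i j y
        - hessian (localMetric g φ) (f ∘ φ.symm) i j y
  codiff_eq : ∀ φ : OpenPartialHomeomorph M (Coord n), IsChart φ → ∀ y ∈ φ.target, ∀ i j,
    codiff (localMetric g φ) (components T φ) i j y =
      - gradInterior (localMetric g φ) (components T φ) (f ∘ φ.symm) i j y
  closed : IsClosedForm T

/-- `‖T‖²` is a constant function on `M`. -/
def HasConstantNorm (g : Metric n M) (T : ThreeForm n M) : Prop :=
  ∃ c : ℝ, ∀ φ : OpenPartialHomeomorph M (Coord n), IsChart φ → ∀ y ∈ φ.target,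
    normSq (localMetric g φ) (components T φ) y = c

/-- The Riemannian scalar curvature is a constant function on `M`. -/
def HasConstantScalarCurvature (g : Metric n M) : Prop :=
  ∃ c : ℝ, ∀ φ : OpenPartialHomeomorph M (Coord n), IsChart φ → ∀ y ∈ φ.target,
    scalarCurvature (localMetric g φ) y = c

/-- The Ricci tensor of the metric connection with skew torsion `T` vanishes. -/
def IsTorsionRicciFlat (g : Metric n M) (T : ThreeForm n M) : Prop :=
  ∀ φ : OpenPartialHomeomorph M (Coord n), IsChart φ → ∀ y ∈ φ.target, ∀ i j,
    ricci (torsionCoeff (localMetric g φ) (components T φ)) i j y = 0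

end Global

end SkewTorsion

end

/-!
The contracted second Bianchi identity, the commutation formula `div Hess f = ∇Δf + Ric^g ∇f`, the
soliton equations and `dT = 0` show that `P = Δf - |∇f|² + ⅙ ‖T‖²` has vanishing gradient; this is
checked at the origin of normal coordinates, and `P` is independent of the chart. Since
`Scal^g = ¼ ‖T‖² - Δf`, and since `Ric = 0` forces `Δf = 0` (the symmetric part of `Ric` is
`-∇^g ∇^g f`), each of the conditions a), c), d) turns into an equation `Δf = β |∇f|² + k` with
constants `β` and `k`. Evaluating it at a maximum and at a minimum of `f` gives `k = 0`, and the
strong maximum principle then makes `f` constant. Conversely, if `f` is constant, then `δT = 0`,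
`P = ⅙ ‖T‖²`, and the rest follows from `Ric = Ric^g - ¼ T² - ½ δT`.
-/

noncomputable section

namespace SkewTorsion

open Topology

variable {n : ℕ} {s : Set (Coord n)} {y : Coord n} {u v : Coord n → ℝ}
  {G : Coord n → Matrix (Fin n) (Fin n) ℝ} {τ : Fin n → Fin n → Fin n → Coord n → ℝ}

/-! ### Partial derivatives -/

lemma differentiableAt_of_contDiffOn (hs : IsOpen s) (hu : ContDiffOn ℝ ∞ u s) (hy : y ∈ s) :
    DifferentiableAt ℝ u y :=
  (hu.contDiffAt (hs.mem_nhds hy)).differentiableAt (by simp)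

lemma contDiffOn_pd (hs : IsOpen s) (hu : ContDiffOn ℝ ∞ u s) (i : Fin n) :
    ContDiffOn ℝ ∞ (pd i u) s :=
  (hu.fderiv_of_isOpen hs (m := ∞) (by simp)).clm_apply contDiffOn_const

lemma pd_congr (hs : IsOpen s) (h : Set.EqOn u v s) (hy : y ∈ s) (i : Fin n) :
    pd i u y = pd i v y := by
  rw [pd, pd, (h.eventuallyEq_of_mem (hs.mem_nhds hy)).fderiv_eq]

lemma pd_const (i : Fin n) (c : ℝ) : pd i (fun _ => c) y = 0 := by
  simp [pd]

lemma pd_add (hu : DifferentiableAt ℝ u y) (hv : DifferentiableAt ℝ v y) (i : Fin n) :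
    pd i (fun z => u z + v z) y = pd i u y + pd i v y := by
  simp [pd, fderiv_fun_add hu hv]

lemma pd_neg (i : Fin n) : pd i (fun z => - u z) y = - pd i u y := by
  simp [pd, fderiv_fun_neg]

lemma pd_sub (hu : DifferentiableAt ℝ u y) (hv : DifferentiableAt ℝ v y) (i : Fin n) :
    pd i (fun z => u z - v z) y = pd i u y - pd i v y := by
  simp [pd, fderiv_fun_sub hu hv]

lemma pd_mul (hu : DifferentiableAt ℝ u y) (hv : DifferentiableAt ℝ v y) (i : Fin n) :
    pd i (fun z => u z * v z) y = pd i u y * v y + u y * pd i v y := by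
  simp only [pd, fderiv_fun_mul hu hv, add_apply, smul_apply, smul_eq_mul]
  ring

lemma pd_mul_eq_zero (hu : DifferentiableAt ℝ u y) (hv : DifferentiableAt ℝ v y) (hu0 : u y = 0)
    (hv0 : v y = 0) (i : Fin n) : pd i (fun z => u z * v z) y = 0 := by
  rw [pd_mul hu hv, hu0, hv0, mul_zero, zero_mul, add_zero]

lemma pd_const_mul (hu : DifferentiableAt ℝ u y) (c : ℝ) (i : Fin n) :
    pd i (fun z => c * u z) y = c * pd i u y := by
  rw [pd_mul (differentiableAt_const c) hu, pd_const, zero_mul, zero_add]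

lemma pd_sum {ι : Type*} (t : Finset ι) {w : ι → Coord n → ℝ}
    (hw : ∀ a, DifferentiableAt ℝ (w a) y) (i : Fin n) :
    pd i (fun z => ∑ a ∈ t, w a z) y = ∑ a ∈ t, pd i (w a) y := by
  simp [pd, fderiv_fun_sum (fun a _ => hw a)]

lemma pd_pd_eq_fderiv_fderiv (hu : ContDiffAt ℝ ∞ u y) (i j : Fin n) :
    pd i (pd j u) y = fderiv ℝ (fderiv ℝ u) y (basisVec i) (basisVec j) := by
  have hd : DifferentiableAt ℝ (fderiv ℝ u) y :=
    (hu.fderiv_right (m := 1) (by norm_cast)).differentiableAt (by simp)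
  change fderiv ℝ (fun z => fderiv ℝ u z (basisVec j)) y (basisVec i) = _
  rw [fderiv_clm_apply hd (differentiableAt_const _)]
  simp

lemma pd_comm (hs : IsOpen s) (hu : ContDiffOn ℝ ∞ u s) (hy : y ∈ s) (i j : Fin n) :
    pd i (pd j u) y = pd j (pd i u) y := by
  have h : ContDiffAt ℝ ∞ u y := hu.contDiffAt (hs.mem_nhds hy)
  have hsymm : IsSymmSndFDerivAt ℝ u y := h.isSymmSndFDerivAt <| by
    rw [minSmoothness_of_isRCLikeNormedField]
    exact WithTop.coe_le_coe.2 (le_top : (2 : ℕ∞) ≤ ⊤)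
  rw [pd_pd_eq_fderiv_fderiv h, pd_pd_eq_fderiv_fderiv h, hsymm]

lemma fderiv_eq_sum_pd (u : Coord n → ℝ) (y w : Coord n) :
    fderiv ℝ u y w = ∑ i, w i * pd i u y := by
  have hw : w = ∑ i, w i • basisVec i := by
    ext j
    simp [basisVec, Pi.single_apply]
  conv_lhs => rw [hw]
  simp [pd]

lemma contDiff_coord (k : Fin n) : ContDiff ℝ ∞ fun z : Coord n => z k :=
  (EuclideanSpace.proj (𝕜 := ℝ) k).contDiff

lemma pd_coord (i k : Fin n) (z : Coord n) :
    pd i (fun z : Coord n => z k) z = if k = i then 1 else 0 := by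
  change fderiv ℝ (EuclideanSpace.proj (𝕜 := ℝ) k) z (basisVec i) = _
  rw [ContinuousLinearMap.fderiv]
  simp [basisVec]

/-- The entry `∂_i ψ^a` of the Jacobian matrix of a map `ψ`. -/
def jacobian (ψ : Coord n → Coord n) (a i : Fin n) : Coord n → ℝ := pd i fun w => ψ w a

lemma jacobian_eq_fderiv {ψ : Coord n → Coord n} (hψ : DifferentiableAt ℝ ψ y) (a i : Fin n) :
    jacobian ψ a i y = fderiv ℝ ψ y (basisVec i) a := by
  have h := ((EuclideanSpace.proj (𝕜 := ℝ) a).hasFDerivAt.comp y hψ.hasFDerivAt).fderiv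
  change fderiv ℝ (EuclideanSpace.proj (𝕜 := ℝ) a ∘ ψ) y (basisVec i) = _
  rw [h]
  rfl

lemma pd_comp {ψ : Coord n → Coord n} (hψ : DifferentiableAt ℝ ψ y)
    (hv : DifferentiableAt ℝ v (ψ y)) (i : Fin n) :
    pd i (fun w => v (ψ w)) y = ∑ a, jacobian ψ a i y * pd a v (ψ y) := by
  simp only [jacobian_eq_fderiv hψ]
  change fderiv ℝ (v ∘ ψ) y (basisVec i) = _
  rw [fderiv_comp y hv hψ, ContinuousLinearMap.comp_apply, fderiv_eq_sum_pd]

/-! ### Exchanging finite sums -/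

lemma sum_sum_sum_comm {α : Type*} [Fintype α] (f : α → α → α → ℝ) :
    ∑ i, ∑ j, ∑ k, f i j k = ∑ k, ∑ i, ∑ j, f i j k :=
  (Finset.sum_congr rfl fun _ _ => Finset.sum_comm).trans Finset.sum_comm

lemma sum_sum_mul_comm {α : Type*} [Fintype α] (A B : α → α → ℝ) (F : α → α → α → α → ℝ) :
    ∑ i, ∑ j, A i j * ∑ p, ∑ q, B p q * F i j p q
      = ∑ p, ∑ q, B p q * ∑ i, ∑ j, A i j * F i j p q := by
  simp only [Finset.mul_sum, mul_left_comm (A _ _)]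
  exact (sum_sum_sum_comm _).trans (Finset.sum_congr rfl fun _ _ => sum_sum_sum_comm _)

/-! ### Metrics on open sets of `ℝⁿ` -/

/-- `G` is the coordinate matrix of a smooth Riemannian metric on the open set `s`. -/
structure IsMetricOn (G : Coord n → Matrix (Fin n) (Fin n) ℝ) (s : Set (Coord n)) : Prop where
  isOpen : IsOpen s
  contDiffOn : ∀ i j, ContDiffOn ℝ ∞ (fun z => G z i j) s
  posDef : ∀ z ∈ s, (G z).PosDef

/-- Twice the Christoffel symbols of the first kind,
`2 Γ_{l,ij} = ∂_i g_{jl} + ∂_j g_{il} - ∂_l g_{ij}`. -/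
def christoffelLow (G : Coord n → Matrix (Fin n) (Fin n) ℝ) (l i j : Fin n) (y : Coord n) : ℝ :=
  pd i (fun z => G z j l) y + pd j (fun z => G z i l) y - pd l (fun z => G z i j) y

/-- The Laplacian `Δu = g^{ij} ∇_i ∇_j u`. -/
def laplacian (G : Coord n → Matrix (Fin n) (Fin n) ℝ) (u : Coord n → ℝ) (y : Coord n) : ℝ :=
  ∑ i, ∑ j, (G y)⁻¹ i j * hessian G u i j y

/-- The squared norm of the gradient, `|∇u|² = g^{ij} ∂_i u ∂_j u`. -/
def gradSq (G : Coord n → Matrix (Fin n) (Fin n) ℝ) (u : Coord n → ℝ) (y : Coord n) : ℝ :=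
  ∑ i, ∑ j, (G y)⁻¹ i j * (pd i u y * pd j u y)

lemma christoffel_eq_christoffelLow (k i j : Fin n) (y : Coord n) :
    christoffel G k i j y = (1 / 2) * ∑ l, (G y)⁻¹ k l * christoffelLow G l i j y := rfl

/-- The Koszul formula: symmetry and metric compatibility determine the connection. -/
lemma christoffelLow_unique {L : Fin n → Fin n → Fin n → ℝ} (hL : ∀ l i j, L l i j = L l j i)
    (hpd : ∀ l i j, pd l (fun z => G z i j) y = L j l i + L i l j) (l i j : Fin n) :
    christoffelLow G l i j y = 2 * L l i j := by
  rw [christoffelLow, hpd, hpd, hpd, hL l j i, hL i j l, hL j l i]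
  ring

lemma torsionSq_eq_sum_inv_mul (i j : Fin n) (y : Coord n) : torsionSq G τ i j y =
    ∑ a, ∑ c, (G y)⁻¹ a c * ∑ b, ∑ d, (G y)⁻¹ b d * (τ i a b y * τ j c d y) := by
  simp only [torsionSq, Finset.mul_sum, ← mul_assoc]
  exact Finset.sum_congr rfl fun _ _ => Finset.sum_comm

lemma contDiffOn_det {A : Coord n → Matrix (Fin n) (Fin n) ℝ}
    (hA : ∀ i j, ContDiffOn ℝ ∞ (fun z => A z i j) s) : ContDiffOn ℝ ∞ (fun z => (A z).det) s := by
  simp only [Matrix.det_apply']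
  exact ContDiffOn.sum fun σ _ => contDiffOn_const.mul (contDiffOn_prod fun i _ => hA _ _)

namespace IsMetricOn

section Algebra

variable (hG : IsMetricOn G s) (hy : y ∈ s)
include hG hy

lemma symm (i j : Fin n) : G y i j = G y j i := by
  simpa using (hG.posDef y hy).1.apply j i

lemma isUnit_det : IsUnit (G y).det :=
  (hG.posDef y hy).det_pos.ne'.isUnit

lemma inv_symm (i j : Fin n) : (G y)⁻¹ i j = (G y)⁻¹ j i := by
  simpa using (hG.posDef y hy).1.inv.apply j i

lemma inv_mul : (G y)⁻¹ * G y = 1 := Matrix.nonsing_inv_mul _ (hG.isUnit_det hy)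

lemma mul_inv : G y * (G y)⁻¹ = 1 := Matrix.mul_nonsing_inv _ (hG.isUnit_det hy)

lemma sum_inv_mul_sum_mul (i : Fin n) (X : Fin n → ℝ) :
    ∑ j, (G y)⁻¹ i j * ∑ k, G y j k * X k = X i := by
  have h := congrFun (Matrix.mulVec_mulVec X (G y)⁻¹ (G y)) i
  rwa [hG.inv_mul hy, Matrix.one_mulVec] at h

lemma sum_mul_sum_inv_mul (i : Fin n) (X : Fin n → ℝ) :
    ∑ j, G y i j * ∑ k, (G y)⁻¹ j k * X k = X i := by
  have h := congrFun (Matrix.mulVec_mulVec X (G y) (G y)⁻¹) i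
  rwa [hG.mul_inv hy, Matrix.one_mulVec] at h

lemma sum_inv_mul_eq_zero_of_antisymm {X : Fin n → Fin n → ℝ} (hX : ∀ i j, X i j = -X j i) :
    ∑ i, ∑ j, (G y)⁻¹ i j * X i j = 0 := by
  refine self_eq_neg.mp ?_
  conv_lhs => rw [Finset.sum_comm]
  simp only [← Finset.sum_neg_distrib]
  refine Finset.sum_congr rfl fun i _ => Finset.sum_congr rfl fun j _ => ?_
  rw [hX j i, hG.inv_symm hy, mul_neg]

end Algebra

section Smoothness

variable (hG : IsMetricOn G s)
include hG

lemma contDiffOn_inv (i j : Fin n) : ContDiffOn ℝ ∞ (fun z => (G z)⁻¹ i j) s := by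
  have h : Set.EqOn (fun z => (G z)⁻¹ i j) (fun z => ((G z).det)⁻¹ * (G z).adjugate i j) s := by
    intro z _
    simp [Matrix.inv_def]
  refine ContDiffOn.congr (((contDiffOn_det hG.contDiffOn).inv
    fun z hz => (hG.posDef z hz).det_pos.ne').mul ?_) h
  simp only [Matrix.adjugate_apply]
  refine contDiffOn_det fun a b => ?_
  by_cases hab : a = j
  · subst hab
    simpa only [Matrix.updateRow_self] using contDiffOn_const
  · simpa only [Matrix.updateRow_ne hab] using hG.contDiffOn a b

lemma contDiffOn_christoffelLow (l i j : Fin n) : ContDiffOn ℝ ∞ (christoffelLow G l i j) s :=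
  ((contDiffOn_pd hG.isOpen (hG.contDiffOn j l) i).add
    (contDiffOn_pd hG.isOpen (hG.contDiffOn i l) j)).sub
      (contDiffOn_pd hG.isOpen (hG.contDiffOn i j) l)

lemma contDiffOn_christoffel (k i j : Fin n) : ContDiffOn ℝ ∞ (christoffel G k i j) s :=
  contDiffOn_const.mul <| ContDiffOn.sum fun l _ =>
    (hG.contDiffOn_inv k l).mul (hG.contDiffOn_christoffelLow l i j)

lemma contDiffOn_sum_sum_inv_mul {X : Fin n → Fin n → Coord n → ℝ}
    (hX : ∀ i j, ContDiffOn ℝ ∞ (X i j) s) :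
    ContDiffOn ℝ ∞ (fun z => ∑ i, ∑ j, (G z)⁻¹ i j * X i j z) s :=
  ContDiffOn.sum fun i _ => ContDiffOn.sum fun j _ => (hG.contDiffOn_inv i j).mul (hX i j)

lemma contDiffOn_hessian (hu : ContDiffOn ℝ ∞ u s) (i j : Fin n) :
    ContDiffOn ℝ ∞ (hessian G u i j) s :=
  (contDiffOn_pd hG.isOpen (contDiffOn_pd hG.isOpen hu j) i).sub <| ContDiffOn.sum fun k _ =>
    (hG.contDiffOn_christoffel k i j).mul (contDiffOn_pd hG.isOpen hu k)

lemma contDiffOn_laplacian (hu : ContDiffOn ℝ ∞ u s) : ContDiffOn ℝ ∞ (laplacian G u) s :=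
  hG.contDiffOn_sum_sum_inv_mul (hG.contDiffOn_hessian hu)

lemma contDiffOn_gradSq (hu : ContDiffOn ℝ ∞ u s) : ContDiffOn ℝ ∞ (gradSq G u) s :=
  hG.contDiffOn_sum_sum_inv_mul fun i j =>
    (contDiffOn_pd hG.isOpen hu i).mul (contDiffOn_pd hG.isOpen hu j)

lemma contDiffOn_torsionSq (hτ : ∀ i j k, ContDiffOn ℝ ∞ (τ i j k) s) (i j : Fin n) :
    ContDiffOn ℝ ∞ (torsionSq G τ i j) s := by
  simp only [funext (torsionSq_eq_sum_inv_mul (G := G) (τ := τ) i j)]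
  exact hG.contDiffOn_sum_sum_inv_mul fun a c =>
    hG.contDiffOn_sum_sum_inv_mul fun b d => (hτ i a b).mul (hτ j c d)

lemma contDiffOn_normSq (hτ : ∀ i j k, ContDiffOn ℝ ∞ (τ i j k) s) :
    ContDiffOn ℝ ∞ (normSq G τ) s :=
  hG.contDiffOn_sum_sum_inv_mul (hG.contDiffOn_torsionSq hτ)

end Smoothness

section LeviCivita

variable (hG : IsMetricOn G s) (hy : y ∈ s)
include hG hy

lemma differentiableAt {v : Coord n → ℝ} (hv : ContDiffOn ℝ ∞ v s) : DifferentiableAt ℝ v y :=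
  differentiableAt_of_contDiffOn hG.isOpen hv hy

lemma pd_symm (l i j : Fin n) : pd l (fun z => G z i j) y = pd l (fun z => G z j i) y :=
  pd_congr hG.isOpen (fun _ hz => hG.symm hz i j) hy l

lemma christoffelLow_symm (l i j : Fin n) :
    christoffelLow G l i j y = christoffelLow G l j i y := by
  rw [christoffelLow, christoffelLow, hG.pd_symm hy l i j]
  ring

lemma christoffel_symm (k i j : Fin n) : christoffel G k i j y = christoffel G k j i y := by
  simp only [christoffel_eq_christoffelLow, hG.christoffelLow_symm hy _ i j]

lemma sum_mul_christoffel (l i j : Fin n) :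
    ∑ k, G y l k * christoffel G k i j y = (1 / 2) * christoffelLow G l i j y := by
  simp only [christoffel_eq_christoffelLow, mul_left_comm _ (1 / 2 : ℝ), ← Finset.mul_sum,
    hG.sum_mul_sum_inv_mul hy]

lemma pd_eq_christoffelLow (l i j : Fin n) : pd l (fun z => G z i j) y =
    (1 / 2) * (christoffelLow G j l i y + christoffelLow G i l j y) := by
  rw [christoffelLow, christoffelLow, hG.pd_symm hy l j i]
  ring

lemma pd_sum_inv_mul {X : Fin n → Coord n → ℝ} (hX : ∀ j, DifferentiableAt ℝ (X j) y)
    (l i : Fin n) : pd l (fun z => ∑ j, (G z)⁻¹ i j * X j z) y =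
      ∑ j, pd l (fun z => (G z)⁻¹ i j) y * X j y + ∑ j, (G y)⁻¹ i j * pd l (X j) y := by
  have dI : ∀ j, DifferentiableAt ℝ (fun z => (G z)⁻¹ i j) y := fun j =>
    hG.differentiableAt hy (hG.contDiffOn_inv i j)
  rw [pd_sum _ fun j => (dI j).fun_mul (hX j), ← Finset.sum_add_distrib]
  exact Finset.sum_congr rfl fun j _ => pd_mul (dI j) (hX j) l

/-- Obtained by differentiating `g⁻¹ g = 1`. -/
lemma pd_inv_eq_neg_mul (l a b : Fin n) : pd l (fun z => (G z)⁻¹ a b) y =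
    - ((G y)⁻¹ * Matrix.of (fun i j => pd l (fun z => G z i j) y) * (G y)⁻¹) a b := by
  set P : Matrix (Fin n) (Fin n) ℝ := Matrix.of fun a b => pd l (fun z => (G z)⁻¹ a b) y
  set D : Matrix (Fin n) (Fin n) ℝ := Matrix.of fun i j => pd l (fun z => G z i j) y
  have hPG : P * G y + (G y)⁻¹ * D = 0 := by
    ext i j
    have h := pd_congr hG.isOpen (fun z hz => congrFun₂ (hG.inv_mul hz) i j) hy l
    simp only [Matrix.mul_apply] at h
    rw [pd_const, hG.pd_sum_inv_mul hy fun k => hG.differentiableAt hy (hG.contDiffOn k j)] at h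
    exact h
  have hP : P = - ((G y)⁻¹ * D * (G y)⁻¹) := by
    rw [← neg_mul, ← eq_neg_of_add_eq_zero_left hPG, mul_assoc, hG.mul_inv hy, mul_one]
  exact congrFun₂ hP a b

lemma pd_inv (l a b : Fin n) : pd l (fun z => (G z)⁻¹ a b) y =
    - (∑ m, christoffel G a l m y * (G y)⁻¹ m b + ∑ m, christoffel G b l m y * (G y)⁻¹ a m) := by
  have h₁ : ∑ m, christoffel G a l m y * (G y)⁻¹ m b =
      ∑ j, ∑ i, (G y)⁻¹ a i * ((1 / 2) * christoffelLow G i l j y) * (G y)⁻¹ j b := by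
    simp only [christoffel_eq_christoffelLow, Finset.mul_sum, Finset.sum_mul,
      mul_left_comm (1 / 2 : ℝ)]
  have h₂ : ∑ m, christoffel G b l m y * (G y)⁻¹ a m =
      ∑ j, ∑ i, (G y)⁻¹ a i * ((1 / 2) * christoffelLow G j l i y) * (G y)⁻¹ j b := by
    rw [Finset.sum_comm]
    simp only [christoffel_eq_christoffelLow, Finset.mul_sum, Finset.sum_mul]
    refine Finset.sum_congr rfl fun m _ => Finset.sum_congr rfl fun j _ => ?_
    rw [hG.inv_symm hy b j]
    ring
  rw [hG.pd_inv_eq_neg_mul hy, h₁, h₂, ← Finset.sum_add_distrib]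
  simp only [Matrix.mul_apply, Matrix.of_apply, Finset.sum_mul, ← Finset.sum_add_distrib,
    hG.pd_eq_christoffelLow hy]
  congr 1
  exact Finset.sum_congr rfl fun j _ => Finset.sum_congr rfl fun i _ => by ring

end LeviCivita

end IsMetricOn

/-! ### Curvature identities in normal coordinates -/

/-- The coordinates are normal to first order at `y`: `g_{ij} = δ_{ij}` and `∂_k g_{ij} = 0`. -/
structure IsNormalAt (G : Coord n → Matrix (Fin n) (Fin n) ℝ) (y : Coord n) : Prop where
  eq_one : G y = 1
  pd_eq_zero : ∀ k i j, pd k (fun z => G z i j) y = 0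

/-- The third order derivatives `∂_a ∂_b ∂_c g_{ij}` of the metric. -/
def metricJet (G : Coord n → Matrix (Fin n) (Fin n) ℝ) (a b c i j : Fin n) (y : Coord n) : ℝ :=
  pd a (pd b (pd c fun z => G z i j)) y

namespace IsMetricOn

variable (hG : IsMetricOn G s) (hy : y ∈ s)
include hG hy

lemma pd_pd_comm (a b i j : Fin n) :
    pd a (pd b fun z => G z i j) y = pd b (pd a fun z => G z i j) y :=
  pd_comm hG.isOpen (hG.contDiffOn i j) hy a b

lemma pd_pd_symm (a b i j : Fin n) :
    pd a (pd b fun z => G z i j) y = pd a (pd b fun z => G z j i) y :=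
  pd_congr hG.isOpen (fun _ hz => hG.pd_symm hz b i j) hy a

lemma metricJet_comm_left (a b c i j : Fin n) :
    metricJet G a b c i j y = metricJet G b a c i j y :=
  pd_comm hG.isOpen (contDiffOn_pd hG.isOpen (hG.contDiffOn i j) c) hy a b

lemma metricJet_comm_right (a b c i j : Fin n) :
    metricJet G a b c i j y = metricJet G a c b i j y :=
  pd_congr hG.isOpen (fun _ hz => hG.pd_pd_comm hz b c i j) hy a

lemma metricJet_symm (a b c i j : Fin n) :
    metricJet G a b c i j y = metricJet G a b c j i y :=
  pd_congr hG.isOpen (fun _ hz => hG.pd_pd_symm hz b c i j) hy a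

lemma pd_christoffelLow (l k i j : Fin n) : pd l (christoffelLow G k i j) y =
    pd l (pd i fun z => G z j k) y + pd l (pd j fun z => G z i k) y
      - pd l (pd k fun z => G z i j) y := by
  have d : ∀ i j k, DifferentiableAt ℝ (pd k fun z => G z i j) y := fun i j k =>
    hG.differentiableAt hy (contDiffOn_pd hG.isOpen (hG.contDiffOn i j) k)
  unfold christoffelLow
  rw [pd_sub ((d _ _ _).fun_add (d _ _ _)) (d _ _ _), pd_add (d _ _ _) (d _ _ _)]

lemma pd_pd_christoffelLow (m l k i j : Fin n) : pd m (pd l (christoffelLow G k i j)) y =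
    metricJet G m l i j k y + metricJet G m l j i k y - metricJet G m l k i j y := by
  have ho := hG.isOpen
  have d : ∀ i j k l, DifferentiableAt ℝ (pd l (pd k fun z => G z i j)) y := fun i j k l =>
    hG.differentiableAt hy (contDiffOn_pd ho (contDiffOn_pd ho (hG.contDiffOn i j) k) l)
  rw [pd_congr ho (fun z hz => hG.pd_christoffelLow hz l k i j) hy,
    pd_sub ((d _ _ _ _).fun_add (d _ _ _ _)) (d _ _ _ _), pd_add (d _ _ _ _) (d _ _ _ _)]
  rfl

end IsMetricOn

namespace IsNormalAt

section Pointwise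

variable (hN : IsNormalAt G y)
include hN

lemma inv_apply (i j : Fin n) : (G y)⁻¹ i j = if i = j then 1 else 0 := by
  rw [hN.eq_one, inv_one, Matrix.one_apply]

lemma sum_inv_mul (i : Fin n) (X : Fin n → ℝ) : ∑ j, (G y)⁻¹ i j * X j = X i := by
  simp [hN.inv_apply]

lemma sum_sum_inv_mul (X : Fin n → Fin n → ℝ) : ∑ i, ∑ j, (G y)⁻¹ i j * X i j = ∑ i, X i i :=
  Finset.sum_congr rfl fun i _ => hN.sum_inv_mul i (X i)

lemma christoffelLow_eq_zero (l i j : Fin n) : christoffelLow G l i j y = 0 := by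
  simp [christoffelLow, hN.pd_eq_zero]

lemma christoffel_eq_zero (k i j : Fin n) : christoffel G k i j y = 0 := by
  simp [christoffel_eq_christoffelLow, hN.christoffelLow_eq_zero]

lemma hessian_eq (i j : Fin n) : hessian G u i j y = pd i (pd j u) y := by
  simp [hessian, hN.christoffel_eq_zero]

lemma ricci_eq (j k : Fin n) : ricci (christoffel G) j k y =
    ∑ i, (pd i (christoffel G i j k) y - pd j (christoffel G i i k) y) := by
  simp [ricci, curvature, hN.christoffel_eq_zero]

end Pointwise

variable (hN : IsNormalAt G y) (hG : IsMetricOn G s) (hy : y ∈ s)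
include hN hG hy

lemma pd_inv (l i j : Fin n) : pd l (fun z => (G z)⁻¹ i j) y = 0 := by
  simp [hG.pd_inv hy, hN.christoffel_eq_zero]

lemma pd_sum_inv_mul {X : Fin n → Coord n → ℝ} (hX : ∀ j, DifferentiableAt ℝ (X j) y)
    (l i : Fin n) : pd l (fun z => ∑ j, (G z)⁻¹ i j * X j z) y = pd l (X i) y := by
  simp [hG.pd_sum_inv_mul hy hX, hN.pd_inv hG hy, hN.inv_apply]

lemma pd_sum_sum_inv_mul {X : Fin n → Fin n → Coord n → ℝ}
    (hX : ∀ i j, ContDiffOn ℝ ∞ (X i j) s) (l : Fin n) :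
    pd l (fun z => ∑ i, ∑ j, (G z)⁻¹ i j * X i j z) y = ∑ i, pd l (X i i) y := by
  rw [pd_sum _ fun i => hG.differentiableAt hy
    (ContDiffOn.sum fun j _ => (hG.contDiffOn_inv i j).mul (hX i j))]
  exact Finset.sum_congr rfl fun i _ =>
    hN.pd_sum_inv_mul hG hy (fun j => hG.differentiableAt hy (hX i j)) l i

lemma pd_pd_sum_inv_mul {X : Fin n → Coord n → ℝ} (hX : ∀ j, ContDiffOn ℝ ∞ (X j) s)
    (hX0 : ∀ j, X j y = 0) (m l i : Fin n) :
    pd m (pd l (fun z => ∑ j, (G z)⁻¹ i j * X j z)) y = pd m (pd l (X i)) y := by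
  have ho := hG.isOpen
  have hI' : ∀ j, ContDiffOn ℝ ∞ (pd l (fun w => (G w)⁻¹ i j)) s := fun j =>
    contDiffOn_pd ho (hG.contDiffOn_inv i j) l
  have hX' : ∀ j, ContDiffOn ℝ ∞ (pd l (X j)) s := fun j => contDiffOn_pd ho (hX j) l
  have hIX : ∀ j, ContDiffOn ℝ ∞ (fun z => pd l (fun w => (G w)⁻¹ i j) z * X j z) s := fun j =>
    (hI' j).mul (hX j)
  have h0 : ∀ j, pd m (fun z => pd l (fun w => (G w)⁻¹ i j) z * X j z) y = 0 := fun j =>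
    pd_mul_eq_zero (hG.differentiableAt hy (hI' j)) (hG.differentiableAt hy (hX j))
      (hN.pd_inv hG hy l i j) (hX0 j) m
  rw [pd_congr ho (fun z hz => hG.pd_sum_inv_mul hz
      (fun j => hG.differentiableAt hz (hX j)) l i) hy,
    pd_add (hG.differentiableAt hy (ContDiffOn.sum fun j _ => hIX j))
      (hG.differentiableAt hy (ContDiffOn.sum fun j _ => (hG.contDiffOn_inv i j).mul (hX' j))),
    pd_sum _ fun j => hG.differentiableAt hy (hIX j),
    hN.pd_sum_inv_mul hG hy fun j => hG.differentiableAt hy (hX' j)]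
  simp only [h0, Finset.sum_const_zero, zero_add]

lemma pd_christoffel (l k i j : Fin n) : pd l (christoffel G k i j) y = (1 / 2) *
    (pd l (pd i fun z => G z j k) y + pd l (pd j fun z => G z i k) y
      - pd l (pd k fun z => G z i j) y) := by
  rw [← hG.pd_christoffelLow hy, ← hN.pd_sum_inv_mul hG hy
    (fun l => hG.differentiableAt hy (hG.contDiffOn_christoffelLow l i j)) l k]
  exact pd_const_mul (hG.differentiableAt hy <| ContDiffOn.sum fun a _ =>
    (hG.contDiffOn_inv k a).mul (hG.contDiffOn_christoffelLow a i j)) _ _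

lemma pd_pd_christoffel (m l k i j : Fin n) : pd m (pd l (christoffel G k i j)) y = (1 / 2) *
    (metricJet G m l i j k y + metricJet G m l j i k y - metricJet G m l k i j y) := by
  have ho := hG.isOpen
  have hs : ContDiffOn ℝ ∞ (fun z => ∑ l, (G z)⁻¹ k l * christoffelLow G l i j z) s :=
    ContDiffOn.sum fun a _ => (hG.contDiffOn_inv k a).mul (hG.contDiffOn_christoffelLow a i j)
  rw [← hG.pd_pd_christoffelLow hy,
    ← hN.pd_pd_sum_inv_mul hG hy (fun l => hG.contDiffOn_christoffelLow l i j)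
      (fun l => hN.christoffelLow_eq_zero l i j) m l k,
    ← pd_const_mul (hG.differentiableAt hy (contDiffOn_pd ho hs l))]
  exact pd_congr ho (fun z hz => pd_const_mul (hG.differentiableAt hz hs) _ _) hy _

lemma pd_ricci_eq_sum_pd_pd_christoffel (l j k : Fin n) : pd l (ricci (christoffel G) j k) y =
    ∑ i, (pd l (pd i (christoffel G i j k)) y - pd l (pd j (christoffel G i i k)) y) := by
  have hΓ := hG.contDiffOn_christoffel
  have dΓ : ∀ k i j, DifferentiableAt ℝ (christoffel G k i j) y := fun k i j =>
    hG.differentiableAt hy (hΓ k i j)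
  have d : ∀ l k i j, DifferentiableAt ℝ (pd l (christoffel G k i j)) y := fun l k i j =>
    hG.differentiableAt hy (contDiffOn_pd hG.isOpen (hΓ k i j) l)
  have dΓΓ : ∀ a b c d e f, DifferentiableAt ℝ
      (fun z => christoffel G a b c z * christoffel G d e f z) y := fun _ _ _ _ _ _ =>
    (dΓ _ _ _).fun_mul (dΓ _ _ _)
  have hΓΓ : ∀ a b c d e f, pd l (fun z => christoffel G a b c z * christoffel G d e f z) y = 0 :=
    fun _ _ _ _ _ _ => pd_mul_eq_zero (dΓ _ _ _) (dΓ _ _ _) (hN.christoffel_eq_zero _ _ _)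
      (hN.christoffel_eq_zero _ _ _) l
  have dq : ∀ i m, DifferentiableAt ℝ (fun z => christoffel G i i m z * christoffel G m j k z
      - christoffel G i j m z * christoffel G m i k z) y := fun _ _ =>
    (dΓΓ _ _ _ _ _ _).fun_sub (dΓΓ _ _ _ _ _ _)
  have dsum : ∀ i, DifferentiableAt ℝ (fun z => ∑ m, (christoffel G i i m z * christoffel G m j k z
      - christoffel G i j m z * christoffel G m i k z)) y := fun i =>
    DifferentiableAt.fun_sum fun m _ => dq i m
  unfold ricci curvature
  rw [pd_sum _ fun i => ((d _ _ _ _).fun_sub (d _ _ _ _)).fun_add (dsum i)]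
  refine Finset.sum_congr rfl fun i _ => ?_
  rw [pd_add ((d _ _ _ _).fun_sub (d _ _ _ _)) (dsum i), pd_sub (d _ _ _ _) (d _ _ _ _),
    pd_sum _ (dq i), Finset.sum_eq_zero fun m _ => ?_, add_zero]
  rw [pd_sub (dΓΓ _ _ _ _ _ _) (dΓΓ _ _ _ _ _ _), hΓΓ, hΓΓ, sub_zero]

lemma pd_ricci_eq_sum_metricJet (l j k : Fin n) : pd l (ricci (christoffel G) j k) y = (1 / 2) *
    ∑ i, (metricJet G l i k j i y - metricJet G l i i j k y - metricJet G l j k i i y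
      + metricJet G l j i i k y) := by
  rw [hN.pd_ricci_eq_sum_pd_pd_christoffel hG hy, Finset.mul_sum]
  refine Finset.sum_congr rfl fun i _ => ?_
  rw [hN.pd_pd_christoffel hG hy, hN.pd_pd_christoffel hG hy, hG.metricJet_comm_right hy l i j]
  ring

lemma contracted_bianchi (k : Fin n) : ∑ j, pd j (ricci (christoffel G) j k) y =
    (1 / 2) * ∑ j, pd k (ricci (christoffel G) j j) y := by
  have hdiv : ∑ j, ∑ i, metricJet G j i i j k y = ∑ j, ∑ i, metricJet G j j i i k y := by
    rw [Finset.sum_comm]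
    refine Finset.sum_congr rfl fun i _ => Finset.sum_congr rfl fun j _ => ?_
    rw [hG.metricJet_comm_left hy, hG.metricJet_comm_right hy]
  have htr : ∑ j, ∑ i, metricJet G k i i j j y = ∑ j, ∑ i, metricJet G k j j i i y :=
    Finset.sum_comm
  have hk₁ : ∀ i j, metricJet G j i k j i y = metricJet G k j i j i y := fun i j => by
    rw [hG.metricJet_comm_right hy, hG.metricJet_comm_left hy]
  have hk₂ : ∀ i j, metricJet G j j k i i y = metricJet G k j j i i y := fun i j => by
    rw [hG.metricJet_comm_right hy, hG.metricJet_comm_left hy]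
  have hk₃ : ∀ i j, metricJet G k i j j i y = metricJet G k j i j i y := fun i j =>
    hG.metricJet_comm_right hy k i j j i
  have hk₄ : ∀ i j, metricJet G k j i i j y = metricJet G k j i j i y := fun i j =>
    hG.metricJet_symm hy k j i i j
  simp only [hN.pd_ricci_eq_sum_metricJet hG hy, ← Finset.mul_sum, Finset.sum_add_distrib,
    Finset.sum_sub_distrib, hk₁, hk₂, hk₃, hk₄]
  linear_combination -(1 / 2) * hdiv + (1 / 4) * htr

lemma pd_hessian (hu : ContDiffOn ℝ ∞ u s) (l i j : Fin n) : pd l (hessian G u i j) y =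
    pd l (pd i (pd j u)) y - ∑ k, pd l (christoffel G k i j) y * pd k u y := by
  have hu' : ∀ i, ContDiffOn ℝ ∞ (pd i u) s := contDiffOn_pd hG.isOpen hu
  have hΓ := hG.contDiffOn_christoffel
  unfold hessian
  rw [pd_sub (hG.differentiableAt hy (contDiffOn_pd hG.isOpen (hu' j) i))
      (hG.differentiableAt hy (ContDiffOn.sum fun k _ => (hΓ k i j).mul (hu' k))),
    pd_sum _ fun k => hG.differentiableAt hy ((hΓ k i j).mul (hu' k))]
  congr 1
  refine Finset.sum_congr rfl fun k _ => ?_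
  rw [pd_mul (hG.differentiableAt hy (hΓ k i j)) (hG.differentiableAt hy (hu' k)),
    hN.christoffel_eq_zero, zero_mul, add_zero]

lemma pd_christoffel_sub_pd_christoffel (i j k : Fin n) :
    pd j (christoffel G k i i) y - pd i (christoffel G k i j) y =
      pd i (christoffel G i j k) y - pd j (christoffel G i i k) y := by
  simp only [hN.pd_christoffel hG hy]
  rw [hG.pd_pd_comm hy j i i k, hG.pd_pd_comm hy j k i i, hG.pd_pd_symm hy i j k i,
    hG.pd_pd_symm hy i k j i, hG.pd_pd_comm hy i j i k, hG.pd_pd_symm hy j i k i]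
  ring

/-- The commutation formula behind Bochner's identity. -/
lemma sum_pd_hessian (hu : ContDiffOn ℝ ∞ u s) (j : Fin n) :
    ∑ i, pd i (hessian G u i j) y =
      ∑ i, pd j (hessian G u i i) y + ∑ k, ricci (christoffel G) j k y * pd k u y := by
  have ho := hG.isOpen
  have hcomm : ∀ i, pd i (pd i (pd j u)) y = pd j (pd i (pd i u)) y := fun i => by
    rw [pd_congr ho (fun z hz => pd_comm ho hu hz i j) hy, pd_comm ho (contDiffOn_pd ho hu i) hy]
  have hric : ∑ k, ricci (christoffel G) j k y * pd k u y = ∑ i, ∑ k,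
      (pd i (christoffel G i j k) y - pd j (christoffel G i i k) y) * pd k u y := by
    rw [Finset.sum_comm]
    simp only [hN.ricci_eq, Finset.sum_mul]
  rw [hric, ← Finset.sum_add_distrib]
  refine Finset.sum_congr rfl fun i _ => ?_
  simp only [hN.pd_hessian hG hy hu, hcomm, ← hN.pd_christoffel_sub_pd_christoffel hG hy i j,
    sub_mul, Finset.sum_sub_distrib]
  ring

end IsNormalAt

/-! ### The conserved quantity of a gradient soliton -/

/-- The components `τ` are totally skew-symmetric. -/
structure IsAlternating (τ : Fin n → Fin n → Fin n → Coord n → ℝ) : Prop where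
  swap_left : ∀ i j k z, τ i j k z = - τ j i k z
  swap_right : ∀ i j k z, τ i j k z = - τ i k j z

/-- The vanishing of the exterior derivative of `τ` at `y`, in components. -/
def IsClosedAt (τ : Fin n → Fin n → Fin n → Coord n → ℝ) (y : Coord n) : Prop :=
  ∀ i j a b, pd i (τ j a b) y - pd j (τ i a b) y + pd a (τ i j b) y - pd b (τ i j a) y = 0

/-- `(G, τ, u)` is a generalized gradient Ricci soliton on the open set `s` of `ℝⁿ`. -/
structure IsSolitonOn (G : Coord n → Matrix (Fin n) (Fin n) ℝ)
    (τ : Fin n → Fin n → Fin n → Coord n → ℝ) (u : Coord n → ℝ) (s : Set (Coord n)) : Prop where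
  isMetricOn : IsMetricOn G s
  contDiffOn_form : ∀ i j k, ContDiffOn ℝ ∞ (τ i j k) s
  contDiffOn_potential : ContDiffOn ℝ ∞ u s
  isAlternating : IsAlternating τ
  isClosedAt : ∀ z ∈ s, IsClosedAt τ z
  ricci_eq : ∀ z ∈ s, ∀ i j,
    ricci (christoffel G) i j z = (1 / 4) * torsionSq G τ i j z - hessian G u i j z
  codiff_eq : ∀ z ∈ s, ∀ i j, codiff G τ i j z = - gradInterior G τ u i j z

/-- The function `Δu - |∇u|² + ⅙ ‖τ‖²`, which is constant on a gradient soliton. -/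
def solitonPotential (G : Coord n → Matrix (Fin n) (Fin n) ℝ)
    (τ : Fin n → Fin n → Fin n → Coord n → ℝ) (u : Coord n → ℝ) (y : Coord n) : ℝ :=
  laplacian G u y - gradSq G u y + (1 / 6) * normSq G τ y

namespace IsAlternating

variable (hτ : IsAlternating τ)
include hτ

lemma pd_swap_left (l i j k : Fin n) (y : Coord n) : pd l (τ i j k) y = - pd l (τ j i k) y := by
  rw [funext (hτ.swap_left i j k), pd_neg]

/-- The contraction of `dτ = 0` with `τ`. -/
lemma three_mul_sum_mul_pd (hc : IsClosedAt τ y) (j : Fin n) :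
    3 * ∑ i, ∑ a, ∑ b, τ i a b y * pd i (τ j a b) y =
      ∑ i, ∑ a, ∑ b, τ i a b y * pd j (τ i a b) y := by
  have h : ∀ i a b, τ i a b y * pd j (τ i a b) y = τ i a b y * pd i (τ j a b) y
      + τ a i b y * pd a (τ j i b) y + τ b i a y * pd b (τ j i a) y := by
    intro i a b
    have hd := hc i j a b
    rw [hτ.pd_swap_left a i j b, hτ.pd_swap_left b i j a] at hd
    rw [hτ.swap_left a i b y, hτ.swap_left b i a y, hτ.swap_right i b a y]
    linear_combination - τ i a b y * hd
  have h₁ : ∑ i, ∑ a, ∑ b, τ a i b y * pd a (τ j i b) y =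
      ∑ i, ∑ a, ∑ b, τ i a b y * pd i (τ j a b) y := Finset.sum_comm
  have h₂ : ∑ i, ∑ a, ∑ b, τ b i a y * pd b (τ j i a) y =
      ∑ i, ∑ a, ∑ b, τ i a b y * pd i (τ j a b) y := sum_sum_sum_comm _
  simp only [h, Finset.sum_add_distrib, h₁, h₂]
  ring

end IsAlternating

namespace IsNormalAt

section Pointwise

variable (hN : IsNormalAt G y)
include hN

lemma torsionSq_eq (i j : Fin n) : torsionSq G τ i j y = ∑ a, ∑ b, τ i a b y * τ j a b y := by
  simp only [torsionSq_eq_sum_inv_mul, hN.sum_sum_inv_mul]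

lemma codiff_eq (i j : Fin n) : codiff G τ i j y = - ∑ m, pd m (τ m i j) y := by
  simp [codiff, hN.sum_sum_inv_mul, covDeriv, hN.christoffel_eq_zero]

lemma gradInterior_eq (i j : Fin n) :
    gradInterior G τ u i j y = ∑ m, pd m u y * τ m i j y := by
  simp only [gradInterior, mul_assoc, hN.sum_sum_inv_mul]

end Pointwise

variable (hN : IsNormalAt G y)
include hN

lemma pd_torsionSq (hG : IsMetricOn G s) (hy : y ∈ s) (hτ : ∀ i j k, ContDiffOn ℝ ∞ (τ i j k) s)
    (l i j : Fin n) : pd l (torsionSq G τ i j) y =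
      ∑ a, ∑ b, (pd l (τ i a b) y * τ j a b y + τ i a b y * pd l (τ j a b) y) := by
  have dτ : ∀ i j k, DifferentiableAt ℝ (τ i j k) y := fun i j k =>
    hG.differentiableAt hy (hτ i j k)
  simp only [funext (torsionSq_eq_sum_inv_mul (G := G) (τ := τ) i j)]
  rw [hN.pd_sum_sum_inv_mul hG hy fun a c =>
    hG.contDiffOn_sum_sum_inv_mul fun b d => (hτ i a b).mul (hτ j c d)]
  refine Finset.sum_congr rfl fun a _ => ?_
  rw [hN.pd_sum_sum_inv_mul hG hy fun b d => (hτ i a b).mul (hτ j a d)]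
  exact Finset.sum_congr rfl fun b _ => pd_mul (dτ _ _ _) (dτ _ _ _) l

lemma pd_gradSq (hG : IsMetricOn G s) (hy : y ∈ s) (hu : ContDiffOn ℝ ∞ u s) (l : Fin n) :
    pd l (gradSq G u) y = 2 * ∑ k, pd k u y * pd l (pd k u) y := by
  have hu' : ∀ i, ContDiffOn ℝ ∞ (pd i u) s := contDiffOn_pd hG.isOpen hu
  have d : ∀ i, DifferentiableAt ℝ (pd i u) y := fun i => hG.differentiableAt hy (hu' i)
  refine (hN.pd_sum_sum_inv_mul hG hy (fun i k => (hu' i).mul (hu' k)) l).trans ?_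
  rw [Finset.mul_sum]
  refine Finset.sum_congr rfl fun k _ => ?_
  rw [pd_mul (d k) (d k)]
  ring

lemma pd_laplacian (hG : IsMetricOn G s) (hy : y ∈ s) (hu : ContDiffOn ℝ ∞ u s) (l : Fin n) :
    pd l (laplacian G u) y = ∑ i, pd l (hessian G u i i) y :=
  hN.pd_sum_sum_inv_mul hG hy (hG.contDiffOn_hessian hu) l

lemma pd_normSq (hG : IsMetricOn G s) (hy : y ∈ s) (hτ : ∀ i j k, ContDiffOn ℝ ∞ (τ i j k) s)
    (l : Fin n) : pd l (normSq G τ) y = ∑ i, pd l (torsionSq G τ i i) y :=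
  hN.pd_sum_sum_inv_mul hG hy (hG.contDiffOn_torsionSq hτ) l

lemma pd_normSq_eq_two_mul (hG : IsMetricOn G s) (hy : y ∈ s)
    (hτ : ∀ i j k, ContDiffOn ℝ ∞ (τ i j k) s) (l : Fin n) :
    pd l (normSq G τ) y = 2 * ∑ i, ∑ a, ∑ b, τ i a b y * pd l (τ i a b) y := by
  simp only [hN.pd_normSq hG hy hτ, hN.pd_torsionSq hG hy hτ, Finset.mul_sum]
  exact Finset.sum_congr rfl fun i _ => Finset.sum_congr rfl fun a _ =>
    Finset.sum_congr rfl fun b _ => by ring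

end IsNormalAt

namespace IsSolitonOn

variable (hS : IsSolitonOn G τ u s) (hy : y ∈ s)
include hS hy

lemma pd_ricci (l i j : Fin n) : pd l (ricci (christoffel G) i j) y =
    (1 / 4) * pd l (torsionSq G τ i j) y - pd l (hessian G u i j) y := by
  have hG := hS.isMetricOn
  have hT := hG.contDiffOn_torsionSq hS.contDiffOn_form i j
  rw [pd_congr hG.isOpen (fun z hz => hS.ricci_eq z hz i j) hy,
    pd_sub (hG.differentiableAt hy (contDiffOn_const.mul hT))
      (hG.differentiableAt hy (hG.contDiffOn_hessian hS.contDiffOn_potential i j)),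
    pd_const_mul (hG.differentiableAt hy hT)]

variable (hN : IsNormalAt G y)
include hN

lemma sum_pd_form (a b : Fin n) : ∑ m, pd m (τ m a b) y = ∑ m, pd m u y * τ m a b y := by
  have h := hS.codiff_eq y hy a b
  rwa [hN.codiff_eq, hN.gradInterior_eq, neg_inj] at h

/-- The divergence of `T²`, from the equation for `δT` and the contraction of `dT = 0`. -/
lemma sum_pd_torsionSq (j : Fin n) : ∑ i, pd i (torsionSq G τ i j) y =
    ∑ m, torsionSq G τ j m y * pd m u y + (1 / 6) * pd j (normSq G τ) y := by
  have hG := hS.isMetricOn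
  have hdiv : ∑ i, ∑ a, ∑ b, pd i (τ i a b) y * τ j a b y =
      ∑ m, torsionSq G τ j m y * pd m u y := by
    simp only [hN.torsionSq_eq, Finset.sum_mul]
    rw [← sum_sum_sum_comm fun a b i => pd i (τ i a b) y * τ j a b y,
      ← sum_sum_sum_comm fun a b m => τ j a b y * τ m a b y * pd m u y]
    refine Finset.sum_congr rfl fun a _ => Finset.sum_congr rfl fun b _ => ?_
    rw [← Finset.sum_mul, hS.sum_pd_form hy hN, Finset.sum_mul]
    exact Finset.sum_congr rfl fun m _ => by ring
  have hclosed := hS.isAlternating.three_mul_sum_mul_pd (hS.isClosedAt y hy) j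
  simp only [hN.pd_torsionSq hG hy hS.contDiffOn_form, Finset.sum_add_distrib,
    hN.pd_normSq_eq_two_mul hG hy hS.contDiffOn_form, hdiv]
  linear_combination (1 / 3) * hclosed

lemma sum_ricci_mul_pd (j : Fin n) : ∑ k, ricci (christoffel G) j k y * pd k u y =
    (1 / 4) * ∑ k, torsionSq G τ j k y * pd k u y - (1 / 2) * pd j (gradSq G u) y := by
  rw [hN.pd_gradSq hS.isMetricOn hy hS.contDiffOn_potential]
  simp only [Finset.mul_sum, ← Finset.sum_sub_distrib]
  refine Finset.sum_congr rfl fun k _ => ?_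
  rw [hS.ricci_eq y hy, hN.hessian_eq]
  ring

theorem pd_solitonPotential (j : Fin n) : pd j (solitonPotential G τ u) y = 0 := by
  have hG := hS.isMetricOn
  have hu := hS.contDiffOn_potential
  have hτ := hS.contDiffOn_form
  have hbianchi := hN.contracted_bianchi hG hy j
  simp only [hS.pd_ricci hy, Finset.sum_sub_distrib, ← Finset.mul_sum,
    hS.sum_pd_torsionSq hy hN, hN.sum_pd_hessian hG hy hu, hS.sum_ricci_mul_pd hy hN,
    ← hN.pd_laplacian hG hy hu, ← hN.pd_normSq hG hy hτ] at hbianchi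
  have hΔ := hG.contDiffOn_laplacian hu
  have hgrad := hG.contDiffOn_gradSq hu
  have hnorm := hG.contDiffOn_normSq hτ
  unfold solitonPotential
  rw [pd_add (hG.differentiableAt hy (hΔ.sub hgrad))
      (hG.differentiableAt hy (contDiffOn_const.mul hnorm)),
    pd_sub (hG.differentiableAt hy hΔ) (hG.differentiableAt hy hgrad),
    pd_const_mul (hG.differentiableAt hy hnorm)]
  linear_combination -2 * hbianchi

end IsSolitonOn

/-! ### Changes of coordinates -/

/-- `ψ` is a change of coordinates from `s'` to `s` which pulls back the metric `G` to `G'`. -/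
structure IsIsometryOn (ψ : Coord n → Coord n) (G' : Coord n → Matrix (Fin n) (Fin n) ℝ)
    (s' : Set (Coord n)) (G : Coord n → Matrix (Fin n) (Fin n) ℝ) (s : Set (Coord n)) : Prop where
  source : IsMetricOn G' s'
  target : IsMetricOn G s
  contDiffOn : ContDiffOn ℝ ∞ ψ s'
  mapsTo : Set.MapsTo ψ s' s
  metric_eq : ∀ z ∈ s', ∀ i j, G' z i j =
    ∑ a, ∑ b, jacobian ψ a i z * jacobian ψ b j z * G (ψ z) a b

/-- The components `∂_i ∂_j ψ^e + Γ^e_{ab} ∂_i ψ^a ∂_j ψ^b` of the covariant derivative along `ψ`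
of the vector field `∂_j ψ` in the direction `∂_i`. -/
def covJacobian (ψ : Coord n → Coord n) (G : Coord n → Matrix (Fin n) (Fin n) ℝ) (e i j : Fin n)
    (z : Coord n) : ℝ :=
  pd i (jacobian ψ e j) z
    + ∑ a, ∑ b, jacobian ψ a i z * jacobian ψ b j z * christoffel G e a b (ψ z)

lemma mul_inv_transpose_mul_mul_mul_transpose {ι : Type*} [Fintype ι] [DecidableEq ι]
    {A J : Matrix ι ι ℝ} (h : IsUnit (J.transpose * A * J).det) :
    J * (J.transpose * A * J)⁻¹ * J.transpose = A⁻¹ := by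
  have hJ : IsUnit J.det := by
    rw [Matrix.det_mul] at h
    exact isUnit_of_mul_isUnit_right h
  have hJt : IsUnit J.transpose.det := by rwa [Matrix.det_transpose]
  rw [Matrix.mul_inv_rev, Matrix.mul_inv_rev, ← Matrix.mul_assoc, ← Matrix.mul_assoc,
    Matrix.mul_nonsing_inv _ hJ, Matrix.one_mul, Matrix.mul_assoc, Matrix.nonsing_inv_mul _ hJt,
    Matrix.mul_one]

namespace IsIsometryOn

variable {ψ : Coord n → Coord n} {G' : Coord n → Matrix (Fin n) (Fin n) ℝ} {s' : Set (Coord n)}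
  {z : Coord n} {τ' : Fin n → Fin n → Fin n → Coord n → ℝ}
  (h : IsIsometryOn ψ G' s' G s) (hz : z ∈ s')
include h hz

section Contraction

lemma sum_jacobian_mul_sum_inv_mul (e : Fin n) (W : Fin n → ℝ) :
    ∑ k, jacobian ψ e k z * ∑ l, (G' z)⁻¹ k l * ∑ c, jacobian ψ c l z * W c =
      ∑ c, (G (ψ z))⁻¹ e c * W c := by
  set J : Matrix (Fin n) (Fin n) ℝ := Matrix.of fun a i => jacobian ψ a i z
  have hG' : G' z = J.transpose * G (ψ z) * J := by
    ext i j
    simp only [h.metric_eq z hz, Matrix.mul_apply, Finset.sum_mul, J, Matrix.transpose_apply,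
      Matrix.of_apply]
    rw [Finset.sum_comm]
    exact Finset.sum_congr rfl fun b _ => Finset.sum_congr rfl fun a _ => by ring
  have hdet := h.source.isUnit_det hz
  rw [hG'] at hdet
  have hW := congrFun
    (congrArg (Matrix.mulVec · W) (mul_inv_transpose_mul_mul_mul_transpose hdet)) e
  rw [← hG'] at hW
  simp only [← Matrix.mulVec_mulVec] at hW
  exact hW

lemma sum_inv_mul_pullback (B : Fin n → Fin n → ℝ) :
    ∑ i, ∑ j, (G' z)⁻¹ i j * ∑ a, ∑ b, jacobian ψ a i z * jacobian ψ b j z * B a b =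
      ∑ a, ∑ b, (G (ψ z))⁻¹ a b * B a b := by
  simp only [← h.sum_jacobian_mul_sum_inv_mul hz, Finset.mul_sum]
  refine (sum_sum_sum_comm _).trans ?_
  exact Finset.sum_congr rfl fun a _ => Finset.sum_congr rfl fun i _ =>
    Finset.sum_congr rfl fun j _ => Finset.sum_congr rfl fun b _ => by ring

lemma sum_inv_mul_pullback_mul (x w : Fin n → ℝ) :
    ∑ i, ∑ j, (G' z)⁻¹ i j * ((∑ a, jacobian ψ a i z * x a) * ∑ b, jacobian ψ b j z * w b) =
      ∑ a, ∑ b, (G (ψ z))⁻¹ a b * (x a * w b) := by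
  simp only [← h.sum_inv_mul_pullback hz, Finset.sum_mul_sum, mul_mul_mul_comm]

end Contraction

section Derivatives

lemma differentiableAt : DifferentiableAt ℝ ψ z :=
  (h.contDiffOn.contDiffAt (h.source.isOpen.mem_nhds hz)).differentiableAt (by simp)

omit hz in
lemma contDiffOn_jacobian (a i : Fin n) : ContDiffOn ℝ ∞ (jacobian ψ a i) s' :=
  contDiffOn_pd h.source.isOpen (contDiffOn_euclidean.1 h.contDiffOn a) i

lemma differentiableAt_jacobian (a i : Fin n) : DifferentiableAt ℝ (jacobian ψ a i) z :=
  h.source.differentiableAt hz (h.contDiffOn_jacobian a i)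

lemma differentiableAt_comp (hv : ContDiffOn ℝ ∞ v s) :
    DifferentiableAt ℝ (fun w => v (ψ w)) z :=
  (h.target.differentiableAt (h.mapsTo hz) hv).comp z (h.differentiableAt hz)

lemma pd_comp (hv : ContDiffOn ℝ ∞ v s) (i : Fin n) :
    pd i (fun w => v (ψ w)) z = ∑ a, jacobian ψ a i z * pd a v (ψ z) :=
  SkewTorsion.pd_comp (h.differentiableAt hz) (h.target.differentiableAt (h.mapsTo hz) hv) i

lemma pd_jacobian_comm (a i j : Fin n) :
    pd i (jacobian ψ a j) z = pd j (jacobian ψ a i) z :=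
  pd_comm h.source.isOpen (contDiffOn_euclidean.1 h.contDiffOn a) hz i j

lemma covJacobian_symm (e i j : Fin n) : covJacobian ψ G e i j z = covJacobian ψ G e j i z := by
  rw [covJacobian, covJacobian, h.pd_jacobian_comm hz, Finset.sum_comm]
  simp only [h.target.christoffel_symm (h.mapsTo hz) e, mul_comm (jacobian ψ _ i z)]

omit hz in
lemma sum_mul_covJacobian (hz : ψ z ∈ s) (c i j : Fin n) :
    ∑ k, G (ψ z) c k * covJacobian ψ G k i j z = ∑ k, G (ψ z) c k * pd i (jacobian ψ k j) z
      + (1 / 2) * ∑ a, ∑ b, jacobian ψ a i z * jacobian ψ b j z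
        * christoffelLow G c a b (ψ z) := by
  simp only [covJacobian, mul_add, Finset.sum_add_distrib]
  simp only [Finset.mul_sum, mul_left_comm (1 / 2 : ℝ), ← h.target.sum_mul_christoffel hz,
    mul_left_comm (G _ _ _)]
  exact congrArg _ (sum_sum_sum_comm _).symm

lemma pd_metric (l i j : Fin n) : pd l (fun w => G' w i j) z = ∑ a, ∑ b,
      ((pd l (jacobian ψ a i) z * jacobian ψ b j z + jacobian ψ a i z * pd l (jacobian ψ b j) z)
        * G (ψ z) a b + ∑ c, jacobian ψ c l z * jacobian ψ a i z * jacobian ψ b j z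
          * pd c (fun w => G w a b) (ψ z)) := by
  have dJ := h.differentiableAt_jacobian hz
  have dG : ∀ a b, DifferentiableAt ℝ (fun w => G (ψ w) a b) z := fun a b =>
    h.differentiableAt_comp hz (h.target.contDiffOn a b)
  have dt : ∀ a b, DifferentiableAt ℝ
      (fun w => jacobian ψ a i w * jacobian ψ b j w * G (ψ w) a b) z := fun a b =>
    ((dJ a i).fun_mul (dJ b j)).fun_mul (dG a b)
  rw [pd_congr h.source.isOpen (fun w hw => h.metric_eq w hw i j) hz,
    pd_sum _ fun a => DifferentiableAt.fun_sum fun b _ => dt a b]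
  refine Finset.sum_congr rfl fun a _ => ?_
  rw [pd_sum _ (dt a)]
  refine Finset.sum_congr rfl fun b _ => ?_
  rw [pd_mul ((dJ a i).fun_mul (dJ b j)) (dG a b), pd_mul (dJ a i) (dJ b j),
    h.pd_comp hz (h.target.contDiffOn a b), Finset.mul_sum]
  congr 1
  exact Finset.sum_congr rfl fun c _ => by ring

lemma pd_metric_eq_sum_covJacobian (l i j : Fin n) : pd l (fun w => G' w i j) z =
    ∑ c, jacobian ψ c j z * ∑ k, G (ψ z) c k * covJacobian ψ G k l i z
      + ∑ c, jacobian ψ c i z * ∑ k, G (ψ z) c k * covJacobian ψ G k l j z := by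
  have hψz := h.mapsTo hz
  set J : Fin n → Fin n → ℝ := fun a i => jacobian ψ a i z
  set K : Fin n → Fin n → Fin n → ℝ := fun a i j => pd i (jacobian ψ a j) z
  set g : Fin n → Fin n → ℝ := fun a b => G (ψ z) a b
  set Γ : Fin n → Fin n → Fin n → ℝ := fun c a b => (1 / 2) * christoffelLow G c a b (ψ z)
  have hexpand : ∀ i j, ∑ c, J c j * ∑ k, g c k * covJacobian ψ G k l i z =
      ∑ c, ∑ k, J c j * (g c k * K k l i) + ∑ c, ∑ a, ∑ b, J c j * (J a l * J b i * Γ c a b) := by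
    intro i j
    simp only [g, h.sum_mul_covJacobian hψz, mul_add, Finset.mul_sum, Finset.sum_add_distrib,
      J, K, Γ, mul_left_comm (1 / 2 : ℝ)]
  have hK : ∑ c, ∑ k, J c j * (g c k * K k l i) = ∑ a, ∑ b, K a l i * J b j * g a b := by
    rw [Finset.sum_comm]
    refine Finset.sum_congr rfl fun a _ => Finset.sum_congr rfl fun b _ => ?_
    simp only [g, h.target.symm hψz b a]
    ring
  have hΓ₁ : ∑ c, ∑ a, ∑ b, J c j * (J a l * J b i * Γ c a b) =
      ∑ a, ∑ b, ∑ c, J c l * J a i * J b j * Γ b c a := by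
    rw [sum_sum_sum_comm]
    exact Finset.sum_congr rfl fun a _ => Finset.sum_congr rfl fun b _ =>
      Finset.sum_congr rfl fun c _ => by ring
  have hΓ₂ : ∑ c, ∑ a, ∑ b, J c i * (J a l * J b j * Γ c a b) =
      ∑ a, ∑ b, ∑ c, J c l * J a i * J b j * Γ a c b := by
    refine Finset.sum_congr rfl fun a _ => Finset.sum_comm.trans ?_
    exact Finset.sum_congr rfl fun b _ => Finset.sum_congr rfl fun c _ => by ring
  have hpd : ∀ a b, ∑ c, J c l * J a i * J b j * pd c (fun w => G w a b) (ψ z) =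
      ∑ c, J c l * J a i * J b j * Γ b c a + ∑ c, J c l * J a i * J b j * Γ a c b := fun a b => by
    simp only [h.target.pd_eq_christoffelLow hψz, mul_add, Finset.sum_add_distrib, Γ]
  rw [hexpand, hexpand, hK, hΓ₁, hΓ₂, h.pd_metric hz]
  simp only [← Finset.sum_add_distrib]
  refine Finset.sum_congr rfl fun a _ => Finset.sum_congr rfl fun b _ => ?_
  linear_combination hpd a b

end Derivatives

section Christoffel

lemma christoffelLow_eq (l i j : Fin n) : christoffelLow G' l i j z =
    2 * ∑ c, jacobian ψ c l z * ∑ k, G (ψ z) c k * covJacobian ψ G k i j z := by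
  refine christoffelLow_unique
    (L := fun l i j => ∑ c, jacobian ψ c l z * ∑ k, G (ψ z) c k * covJacobian ψ G k i j z)
    (fun l i j => ?_) (h.pd_metric_eq_sum_covJacobian hz) l i j
  simp only [h.covJacobian_symm hz _ i j]

lemma sum_jacobian_mul_christoffel (e i j : Fin n) :
    ∑ k, jacobian ψ e k z * christoffel G' k i j z = covJacobian ψ G e i j z := by
  have hhalf : ∀ k, christoffel G' k i j z = ∑ l, (G' z)⁻¹ k l *
      ∑ c, jacobian ψ c l z * ∑ m, G (ψ z) c m * covJacobian ψ G m i j z := fun k => by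
    simp only [christoffel_eq_christoffelLow, h.christoffelLow_eq hz, mul_left_comm _ (2 : ℝ),
      ← Finset.mul_sum]
    ring
  simp only [hhalf, h.sum_jacobian_mul_sum_inv_mul hz,
    h.target.sum_inv_mul_sum_mul (h.mapsTo hz)]

theorem isNormalAt (hG' : G' z = 1) (hψ : ∀ e i j, covJacobian ψ G e i j z = 0) :
    IsNormalAt G' z :=
  ⟨hG', fun l i j => by simp [h.pd_metric_eq_sum_covJacobian hz, hψ]⟩

end Christoffel

section Invariance

theorem gradSq_comp (hu : ContDiffOn ℝ ∞ u s) :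
    gradSq G' (fun w => u (ψ w)) z = gradSq G u (ψ z) := by
  simp only [gradSq, h.pd_comp hz hu, h.sum_inv_mul_pullback_mul hz]

lemma pd_pd_comp (hu : ContDiffOn ℝ ∞ u s) (i j : Fin n) :
    pd i (pd j fun w => u (ψ w)) z = ∑ b, pd i (jacobian ψ b j) z * pd b u (ψ z)
      + ∑ a, ∑ b, jacobian ψ a i z * jacobian ψ b j z * pd a (pd b u) (ψ z) := by
  have hu' : ∀ b, ContDiffOn ℝ ∞ (pd b u) s := contDiffOn_pd h.target.isOpen hu
  have dJ := h.differentiableAt_jacobian hz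
  have du : ∀ b, DifferentiableAt ℝ (fun w => pd b u (ψ w)) z := fun b =>
    h.differentiableAt_comp hz (hu' b)
  rw [pd_congr h.source.isOpen (fun w hw => h.pd_comp hw hu j) hz,
    pd_sum _ fun b => (dJ b j).fun_mul (du b), Finset.sum_comm (γ := Fin n),
    ← Finset.sum_add_distrib]
  refine Finset.sum_congr rfl fun b _ => ?_
  rw [pd_mul (dJ b j) (du b), h.pd_comp hz (hu' b), Finset.mul_sum]
  congr 1
  exact Finset.sum_congr rfl fun a _ => by ring

theorem hessian_comp (hu : ContDiffOn ℝ ∞ u s) (i j : Fin n) :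
    hessian G' (fun w => u (ψ w)) i j z =
      ∑ a, ∑ b, jacobian ψ a i z * jacobian ψ b j z * hessian G u a b (ψ z) := by
  have hΓ : ∑ k, christoffel G' k i j z * pd k (fun w => u (ψ w)) z =
      ∑ e, covJacobian ψ G e i j z * pd e u (ψ z) := by
    simp only [h.pd_comp hz hu, ← h.sum_jacobian_mul_christoffel hz, Finset.mul_sum,
      Finset.sum_mul]
    rw [Finset.sum_comm]
    exact Finset.sum_congr rfl fun e _ => Finset.sum_congr rfl fun k _ => by ring
  have hcomm : ∑ a, ∑ b, jacobian ψ a i z * jacobian ψ b j z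
        * ∑ e, christoffel G e a b (ψ z) * pd e u (ψ z) =
      ∑ e, (∑ a, ∑ b, jacobian ψ a i z * jacobian ψ b j z * christoffel G e a b (ψ z))
        * pd e u (ψ z) := by
    simp only [Finset.mul_sum, Finset.sum_mul, ← mul_assoc]
    exact sum_sum_sum_comm _
  rw [hessian, hΓ, h.pd_pd_comp hz hu]
  simp only [hessian, covJacobian, mul_sub, add_mul, Finset.sum_sub_distrib,
    Finset.sum_add_distrib, hcomm]
  ring

theorem laplacian_comp (hu : ContDiffOn ℝ ∞ u s) :
    laplacian G' (fun w => u (ψ w)) z = laplacian G u (ψ z) := by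
  simp only [laplacian, h.hessian_comp hz hu, h.sum_inv_mul_pullback hz]

variable (hτ : ∀ i j k, τ' i j k z = ∑ a, ∑ b, ∑ c,
  jacobian ψ a i z * jacobian ψ b j z * jacobian ψ c k z * τ a b c (ψ z))
include hτ

theorem torsionSq_comp (i j : Fin n) : torsionSq G' τ' i j z =
    ∑ a, ∑ b, jacobian ψ a i z * jacobian ψ b j z * torsionSq G τ a b (ψ z) := by
  set t : Fin n → Fin n → Fin n → ℝ := fun i b c => ∑ a, jacobian ψ a i z * τ a b c (ψ z)
  have hτ' : ∀ i j k, τ' i j k z = ∑ c, jacobian ψ c k z * ∑ b, jacobian ψ b j z * t i b c := by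
    intro i j k
    simp only [hτ, t, Finset.mul_sum]
    rw [sum_sum_sum_comm]
    refine Finset.sum_congr rfl fun c _ => Finset.sum_comm.trans ?_
    exact Finset.sum_congr rfl fun b _ => Finset.sum_congr rfl fun a _ => by ring
  have hmul : ∀ p q r m, t i p q * t j r m = ∑ a, ∑ b,
      jacobian ψ a i z * jacobian ψ b j z * (τ a p q (ψ z) * τ b r m (ψ z)) := fun p q r m => by
    simp only [t, Finset.sum_mul_sum, mul_mul_mul_comm]
  simp only [torsionSq_eq_sum_inv_mul, hτ', h.sum_inv_mul_pullback_mul hz]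
  refine (sum_sum_mul_comm _ _ _).trans ?_
  simp only [h.sum_inv_mul_pullback_mul hz, hmul]
  refine (sum_sum_mul_comm _ _ _).trans (Eq.trans ?_ (sum_sum_mul_comm _ _ _))
  exact Finset.sum_congr rfl fun p _ => Finset.sum_congr rfl fun q _ =>
    congrArg _ (sum_sum_mul_comm _ _ _)

theorem normSq_comp : normSq G' τ' z = normSq G τ (ψ z) := by
  simp only [normSq, h.torsionSq_comp hz hτ, h.sum_inv_mul_pullback hz]

theorem solitonPotential_comp (hu : ContDiffOn ℝ ∞ u s) :
    solitonPotential G' τ' (fun w => u (ψ w)) z = solitonPotential G τ u (ψ z) := by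
  rw [solitonPotential, solitonPotential, h.laplacian_comp hz hu, h.gradSq_comp hz hu,
    h.normSq_comp hz hτ]

end Invariance

end IsIsometryOn

/-! ### The strong maximum principle -/

lemma deriv_deriv_nonpos_of_isLocalMax {f : ℝ → ℝ} {t : ℝ} (h : IsLocalMax f t)
    (hf : ContinuousAt f t) : deriv (deriv f) t ≤ 0 := by
  by_contra! hpos
  have hmin : IsLocalMin f t := isLocalMin_of_deriv_deriv_pos hpos h.deriv_eq_zero hf
  have hconst : f =ᶠ[𝓝 t] fun _ => f t := by
    filter_upwards [h, hmin] with r hr hr' using le_antisymm hr hr'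
  refine hpos.ne' ?_
  rw [hconst.deriv.deriv_eq]
  simp

lemma hasDerivAt_line (z w : Coord n) (t : ℝ) (hu : DifferentiableAt ℝ u (z + t • w)) :
    HasDerivAt (fun t : ℝ => u (z + t • w)) (∑ i, w i * pd i u (z + t • w)) t := by
  rw [← fderiv_eq_sum_pd]
  have hline : HasDerivAt (fun t : ℝ => z + t • w) w t := by
    simpa using ((hasDerivAt_id t).smul_const w).const_add z
  exact hu.hasFDerivAt.comp_hasDerivAt t hline

lemma tendsto_line (z w : Coord n) :
    Filter.Tendsto (fun t : ℝ => z + t • w) (𝓝 0) (𝓝 z) := by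
  have h : Continuous fun t : ℝ => z + t • w := by fun_prop
  simpa using h.tendsto 0

lemma deriv_deriv_line (hs : IsOpen s) (hu : ContDiffOn ℝ ∞ u s) (hy : y ∈ s) (w : Coord n) :
    deriv (deriv fun t : ℝ => u (y + t • w)) 0
      = ∑ i, ∑ j, w i * w j * pd i (pd j u) y := by
  have hfirst : deriv (fun t : ℝ => u (y + t • w))
      =ᶠ[𝓝 0] fun t => ∑ j, w j * pd j u (y + t • w) := by
    filter_upwards [(tendsto_line y w).eventually (hs.mem_nhds hy)] with t ht
    exact (hasDerivAt_line y w t (differentiableAt_of_contDiffOn hs hu ht)).deriv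
  have hsecond : ∀ j, HasDerivAt (fun t : ℝ => pd j u (y + t • w))
      (∑ i, w i * pd i (pd j u) (y + (0 : ℝ) • w)) 0 := fun j =>
    hasDerivAt_line y w 0 (differentiableAt_of_contDiffOn hs (contDiffOn_pd hs hu j) (by simpa))
  rw [hfirst.deriv_eq, (HasDerivAt.fun_sum fun j _ => (hsecond j).const_mul (w j)).deriv,
    Finset.sum_comm]
  simp only [zero_smul, add_zero, Finset.mul_sum]
  exact Finset.sum_congr rfl fun j _ => Finset.sum_congr rfl fun i _ => by ring

lemma sum_mul_pd_pd_nonpos_of_isLocalMax (hs : IsOpen s) (hu : ContDiffOn ℝ ∞ u s) (hy : y ∈ s)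
    (h : IsLocalMax u y) (w : Coord n) : ∑ i, ∑ j, w i * w j * pd i (pd j u) y ≤ 0 := by
  have hmax : IsLocalMax (fun t : ℝ => u (y + t • w)) 0 := by
    simpa [IsLocalMax, IsMaxFilter] using (tendsto_line y w).eventually h
  rw [← deriv_deriv_line hs hu hy]
  exact deriv_deriv_nonpos_of_isLocalMax hmax
    (hasDerivAt_line y w 0 (differentiableAt_of_contDiffOn hs hu (by simpa))).continuousAt

lemma pd_eq_zero_of_isLocalMax (h : IsLocalMax u y) (i : Fin n) : pd i u y = 0 := by
  simp [pd, h.fderiv_eq_zero]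

/-- The linear second order operator `L u = a_{ij} ∂_i ∂_j u + b_i ∂_i u`. -/
def ellipticOp (A : Coord n → Matrix (Fin n) (Fin n) ℝ) (b : Fin n → Coord n → ℝ)
    (u : Coord n → ℝ) (z : Coord n) : ℝ :=
  ∑ i, ∑ j, A z i j * pd i (pd j u) z + ∑ i, b i z * pd i u z

/-- The operator `ellipticOp A b` has continuous coefficients and is elliptic on the open
set `s`. -/
structure IsEllipticOn (A : Coord n → Matrix (Fin n) (Fin n) ℝ) (b : Fin n → Coord n → ℝ)
    (s : Set (Coord n)) : Prop where
  isOpen : IsOpen s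
  continuousOn_symbol : ∀ i j, ContinuousOn (fun z => A z i j) s
  posDef : ∀ z ∈ s, (A z).PosDef
  continuousOn_drift : ∀ i, ContinuousOn (b i) s

variable {A : Coord n → Matrix (Fin n) (Fin n) ℝ} {b : Fin n → Coord n → ℝ}

lemma ellipticOp_nonpos_of_isLocalMax (hs : IsOpen s) (hu : ContDiffOn ℝ ∞ u s) (hy : y ∈ s)
    (h : IsLocalMax u y) (hA : (A y).PosSemidef) : ellipticOp A b u y ≤ 0 := by
  obtain ⟨m, w, hw⟩ := Matrix.posSemidef_iff_eq_sum_vecMulVec.1 hA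
  have hentry : ∀ i j, A y i j = ∑ k, w k i * w k j := fun i j => by
    simp [hw, Matrix.sum_apply, Matrix.vecMulVec_apply]
  simp only [ellipticOp, pd_eq_zero_of_isLocalMax h, mul_zero, Finset.sum_const_zero, add_zero]
  calc ∑ i, ∑ j, A y i j * pd i (pd j u) y
      = ∑ k, ∑ i, ∑ j, w k i * w k j * pd i (pd j u) y := by
        simp only [hentry, Finset.sum_mul]
        exact (Finset.sum_congr rfl fun i _ => Finset.sum_comm).trans Finset.sum_comm
    _ ≤ 0 := Finset.sum_nonpos fun k _ =>
        sum_mul_pd_pd_nonpos_of_isLocalMax hs hu hy h (WithLp.toLp 2 (w k))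

lemma ellipticOp_add_const_mul (hs : IsOpen s) (hu : ContDiffOn ℝ ∞ u s)
    (hv : ContDiffOn ℝ ∞ v s) (hy : y ∈ s) (ε : ℝ) :
    ellipticOp A b (fun z => u z + ε * v z) y = ellipticOp A b u y + ε * ellipticOp A b v y := by
  have hpd : ∀ {f g : Coord n → ℝ}, ContDiffOn ℝ ∞ f s → ContDiffOn ℝ ∞ g s → ∀ z ∈ s, ∀ i,
      pd i (fun w => f w + ε * g w) z = pd i f z + ε * pd i g z := fun hf hg z hz i => by
    have hgd := differentiableAt_of_contDiffOn hs hg hz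
    rw [pd_add (differentiableAt_of_contDiffOn hs hf hz) (hgd.const_mul ε), pd_const_mul hgd]
  have hpdpd : ∀ i j, pd i (pd j fun w => u w + ε * v w) y
      = pd i (pd j u) y + ε * pd i (pd j v) y := fun i j => by
    rw [pd_congr hs (fun z hz => hpd hu hv z hz j) hy,
      hpd (contDiffOn_pd hs hu j) (contDiffOn_pd hs hv j) y hy]
  simp only [ellipticOp, hpd hu hv y hy, hpdpd, mul_add, Finset.sum_add_distrib, Finset.mul_sum,
    mul_left_comm _ ε]
  ring

lemma IsEllipticOn.not_isLocalMax_add_const_mul (hE : IsEllipticOn A b s)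
    (hu : ContDiffOn ℝ ∞ u s) (hv : ContDiffOn ℝ ∞ v s) (hy : y ∈ s)
    (hLu : 0 ≤ ellipticOp A b u y) (hLv : 0 < ellipticOp A b v y) {ε : ℝ} (hε : 0 < ε) :
    ¬ IsLocalMax (fun z => u z + ε * v z) y := fun h => by
  have hle := ellipticOp_nonpos_of_isLocalMax (b := b) hE.isOpen
    (hu.add (contDiffOn_const.mul hv)) hy h (hE.posDef y hy).posSemidef
  rw [ellipticOp_add_const_mul hE.isOpen hu hv hy] at hle
  linarith [mul_pos hε hLv]

/-- The barrier `exp (-c |z - q|²)`. -/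
def barrier (c : ℝ) (q z : Coord n) : ℝ := Real.exp (-c * ∑ k, (z k - q k) ^ 2)

lemma barrier_eq (c : ℝ) (q z : Coord n) : barrier c q z = Real.exp (-c * dist z q ^ 2) := by
  rw [barrier, dist_eq_norm, EuclideanSpace.real_norm_sq_eq]
  rfl

lemma contDiff_barrier (c : ℝ) (q : Coord n) : ContDiff ℝ ∞ (barrier c q) :=
  (contDiff_const.mul (ContDiff.sum fun k _ =>
    ((contDiff_coord k).sub contDiff_const).pow 2)).exp

lemma differentiableAt_coord_sub (q z : Coord n) (k : Fin n) :
    DifferentiableAt ℝ (fun w : Coord n => w k - q k) z :=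
  ((contDiff_coord k).differentiable (by simp) z).sub_const _

lemma pd_coord_sub (q z : Coord n) (i k : Fin n) :
    pd i (fun w : Coord n => w k - q k) z = if k = i then 1 else 0 := by
  rw [pd_sub ((contDiff_coord k).differentiable (by simp) z) (differentiableAt_const _),
    pd_coord, pd_const, sub_zero]

lemma pd_sum_coord_sub_sq (q z : Coord n) (i : Fin n) :
    pd i (fun w : Coord n => ∑ k, (w k - q k) ^ 2) z = 2 * (z i - q i) := by
  have hd := differentiableAt_coord_sub q z
  simp only [pow_two]
  rw [pd_sum _ fun k => (hd k).fun_mul (hd k)]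
  simp only [fun k => pd_mul (hd k) (hd k) i, pd_coord_sub, ite_mul, mul_ite, one_mul, mul_one,
    zero_mul, mul_zero, Finset.sum_add_distrib, Finset.sum_ite_eq', Finset.mem_univ, if_true]
  ring

lemma pd_barrier (c : ℝ) (q z : Coord n) (i : Fin n) :
    pd i (barrier c q) z = -2 * c * ((z i - q i) * barrier c q z) := by
  have hd : DifferentiableAt ℝ (fun w : Coord n => ∑ k, (w k - q k) ^ 2) z :=
    DifferentiableAt.fun_sum fun k _ => (differentiableAt_coord_sub q z k).pow 2
  have hexp : fderiv ℝ (barrier c q) z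
      = barrier c q z • (-c) • fderiv ℝ (fun w : Coord n => ∑ k, (w k - q k) ^ 2) z :=
    (hd.hasFDerivAt.const_mul (-c)).exp.fderiv
  have hsq := pd_sum_coord_sub_sq q z i
  simp only [pd] at hsq ⊢
  simp only [hexp, smul_apply, smul_eq_mul, hsq]
  ring

lemma pd_pd_barrier (c : ℝ) (q z : Coord n) (i j : Fin n) :
    pd i (pd j (barrier c q)) z = barrier c q z *
      (4 * c ^ 2 * ((z i - q i) * (z j - q j)) - 2 * c * if j = i then 1 else 0) := by
  have hb : DifferentiableAt ℝ (barrier c q) z := (contDiff_barrier c q).differentiable (by simp) z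
  have hd := differentiableAt_coord_sub q z j
  rw [funext fun w => pd_barrier c q w j, pd_const_mul (hd.fun_mul hb), pd_mul hd hb,
    pd_coord_sub, pd_barrier]
  ring

lemma ellipticOp_barrier (c : ℝ) (q z : Coord n) : ellipticOp A b (barrier c q) z
    = barrier c q z * (2 * c * (2 * c * ∑ i, ∑ j, A z i j * ((z i - q i) * (z j - q j))
      - (∑ i, A z i i + ∑ i, b i z * (z i - q i)))) := by
  have hsymbol : ∑ i, ∑ j, A z i j * pd i (pd j (barrier c q)) z
      = barrier c q z * (2 * c * (2 * c * ∑ i, ∑ j, A z i j * ((z i - q i) * (z j - q j))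
        - ∑ i, A z i i)) := by
    have hdiag : ∀ i, A z i i = ∑ j, A z i j * if j = i then 1 else 0 := fun i => by simp
    simp only [hdiag, Finset.mul_sum, ← Finset.sum_sub_distrib, pd_pd_barrier]
    exact Finset.sum_congr rfl fun i _ => Finset.sum_congr rfl fun j _ => by ring
  have hdrift : ∑ i, b i z * pd i (barrier c q) z
      = barrier c q z * (2 * c * -∑ i, b i z * (z i - q i)) := by
    simp only [pd_barrier, Finset.mul_sum, ← Finset.sum_neg_distrib]
    exact Finset.sum_congr rfl fun i _ => by ring
  rw [ellipticOp, hsymbol, hdrift]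
  ring

lemma IsEllipticOn.exists_barrier_pos (hE : IsEllipticOn A b s) {K : Set (Coord n)}
    (hK : IsCompact K) (hKs : K ⊆ s) {q : Coord n} (hq : q ∉ K) :
    ∃ c > 0, ∀ z ∈ K, 0 < ellipticOp A b (barrier c q) z := by
  have hcoord : ∀ k, ContinuousOn (fun z : Coord n => z k - q k) K := fun k =>
    ((contDiff_coord k).continuous.sub continuous_const).continuousOn
  have hsymbol := fun i j => (hE.continuousOn_symbol i j).mono hKs
  obtain ⟨m, hm0, hm⟩ : ∃ m, 0 < m ∧ ∀ z ∈ K,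
      m ≤ ∑ i, ∑ j, A z i j * ((z i - q i) * (z j - q j)) := by
    refine hK.exists_forall_le' (continuousOn_finsetSum _ fun i _ =>
      continuousOn_finsetSum _ fun j _ => (hsymbol i j).mul ((hcoord i).mul (hcoord j)))
      fun z hz => ?_
    have hne : (fun k => z k - q k) ≠ 0 := fun h =>
      hq ((PiLp.ext fun k => sub_eq_zero.1 (congrFun h k) : z = q) ▸ hz)
    refine ((hE.posDef z (hKs hz)).dotProduct_mulVec_pos hne).trans_eq ?_
    simp only [dotProduct, Matrix.mulVec, star_trivial, Finset.mul_sum, Pi.mul_apply]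
    exact Finset.sum_congr rfl fun i _ => Finset.sum_congr rfl fun j _ => by ring
  obtain ⟨C, hC⟩ := hK.exists_bound_of_continuousOn
    (f := fun z => ∑ i, A z i i + ∑ i, b i z * (z i - q i))
    ((continuousOn_finsetSum _ fun i _ => hsymbol i i).add (continuousOn_finsetSum _ fun i _ =>
      ((hE.continuousOn_drift i).mono hKs).mul (hcoord i)))
  have hc : 0 < (|C| + 1) / m := by positivity
  refine ⟨_, hc, fun z hz => ?_⟩
  rw [ellipticOp_barrier]
  refine mul_pos (Real.exp_pos _) (mul_pos (by positivity) ?_)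
  have hlower := (le_abs_self _).trans ((hC z hz).trans (le_abs_self C))
  have hquad : |C| + 1 ≤ (|C| + 1) / m * ∑ i, ∑ j, A z i j * ((z i - q i) * (z j - q j)) :=
    (div_mul_cancel₀ _ hm0.ne').symm.le.trans (mul_le_mul_of_nonneg_left (hm z hz) hc.le)
  linarith [abs_nonneg C]

lemma exists_add_barrier_lt_on_sphere {q x : Coord n} {c ρ : ℝ} (hc : 0 < c)
    (hu : ContinuousOn u (Metric.sphere x ρ)) (hmax : ∀ z ∈ Metric.sphere x ρ, u z ≤ u x)
    (hlt : ∀ z ∈ Metric.sphere x ρ, dist z q ≤ dist x q → u z < u x) :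
    ∃ ε > 0, ∀ z ∈ Metric.sphere x ρ, u z + ε * barrier c q z < u x + ε * barrier c q x := by
  obtain ⟨M, hM, hMle⟩ : ∃ M, 0 < M ∧
      ∀ z ∈ Metric.sphere x ρ ∩ Metric.closedBall q (dist x q), M ≤ u x - u z :=
    ((isCompact_sphere x ρ).inter_right Metric.isClosed_closedBall).exists_forall_le'
      (continuousOn_const.sub (hu.mono Set.inter_subset_left))
      fun z hz => sub_pos.2 (hlt z hz.1 hz.2)
  refine ⟨M, hM, fun z hz => ?_⟩
  rcases le_or_gt (dist z q) (dist x q) with hzq | hzq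
  · have hz1 : barrier c q z ≤ 1 := by
      rw [barrier_eq]
      exact Real.exp_le_one_iff.2 (by nlinarith [sq_nonneg (dist z q)])
    have hx0 : 0 < M * barrier c q x := mul_pos hM (Real.exp_pos _)
    linarith [hMle z ⟨hz, hzq⟩, mul_le_of_le_one_right hM.le hz1]
  · have hbarrier : barrier c q z < barrier c q x := by
      rw [barrier_eq, barrier_eq]
      refine Real.exp_lt_exp.2 (mul_lt_mul_of_neg_left ?_ (neg_lt_zero.2 hc))
      exact pow_lt_pow_left₀ hzq dist_nonneg two_ne_zero
    linarith [hmax z hz, mul_lt_mul_of_pos_left hbarrier hM]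

/-- Hopf's boundary point argument, with a multiple of `barrier` as the comparison function. -/
lemma IsEllipticOn.exists_ne_eq_of_isMax (hE : IsEllipticOn A b s) (hu : ContDiffOn ℝ ∞ u s)
    (hLu : ∀ z ∈ s, 0 ≤ ellipticOp A b u z) {q x : Coord n} (hx : x ∈ s) (hxq : x ≠ q)
    (hmax : ∀ z ∈ s, u z ≤ u x) : ∃ z ∈ s, dist z q ≤ dist x q ∧ z ≠ x ∧ u z = u x := by
  by_contra! hne
  obtain ⟨r, hr0, hr⟩ := Metric.isOpen_iff.1 hE.isOpen x hx
  have hR : 0 < dist x q := dist_pos.2 hxq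
  set ρ := min (r / 2) (dist x q / 2)
  have hρ : 0 < ρ := by positivity
  have hρr : ρ < r := (min_le_left _ _).trans_lt (half_lt_self hr0)
  have hρR : ρ < dist x q := (min_le_right _ _).trans_lt (half_lt_self hR)
  have hsub : Metric.closedBall x ρ ⊆ s := (Metric.closedBall_subset_ball hρr).trans hr
  have hsphere : Metric.sphere x ρ ⊆ s := Metric.sphere_subset_closedBall.trans hsub
  obtain ⟨c, hc, hLb⟩ := hE.exists_barrier_pos (isCompact_closedBall x ρ) hsub
    (q := q) fun h => (Metric.mem_closedBall'.1 h).not_gt hρR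
  obtain ⟨ε, hε, hlt⟩ := exists_add_barrier_lt_on_sphere hc (hu.continuousOn.mono hsphere)
    (fun z hz => hmax z (hsphere hz)) fun z hz hzq => (hmax z (hsphere hz)).lt_of_ne <|
      hne z (hsphere hz) hzq <| Metric.ne_of_mem_sphere hz hρ.ne'
  have hb : ContDiffOn ℝ ∞ (barrier c q) s := (contDiff_barrier c q).contDiffOn
  have hxball := Metric.mem_closedBall_self (x := x) hρ.le
  obtain ⟨p, hp, hpmax⟩ := (isCompact_closedBall x ρ).exists_isMaxOn ⟨x, hxball⟩
    ((hu.add (contDiffOn_const.mul hb)).continuousOn.mono hsub)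
  have hpball : p ∈ Metric.ball x ρ :=
    (Metric.mem_closedBall.1 hp).lt_of_ne fun h => (hlt p h).not_ge (hpmax hxball)
  refine hE.not_isLocalMax_add_const_mul hu hb (hsub hp) (hLu p (hsub hp)) (hLb p hp) hε ?_
  exact hpmax.isLocalMax (Filter.mem_of_superset (Metric.isOpen_ball.mem_nhds hpball)
    Metric.ball_subset_closedBall)

lemma eq_of_dist_midpoint_le {q x z : Coord n} (hz : dist z (midpoint ℝ q x) ≤ dist x q / 2)
    (hxz : dist x q ≤ dist z q) : z = x := by
  have hmid : dist q (midpoint ℝ q x) = dist x q / 2 := by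
    rw [dist_left_midpoint (𝕜 := ℝ), Real.norm_two, dist_comm x q]
    ring
  have htri := dist_triangle z (midpoint ℝ q x) q
  rw [dist_comm (midpoint ℝ q x) q] at htri
  have h := eq_midpoint_of_dist_eq_half (x := q) (y := midpoint ℝ q x) (z := z)
    (by rw [dist_comm q z]; linarith) (by rw [dist_comm q z, dist_comm _ z]; linarith)
  simpa [midpoint_eq_midpoint_iff_vsub_eq_vsub, eq_comm, sub_eq_zero] using h

/-- Otherwise take `q` close to `y` with `u q < u y` and a point `x` of `{u = u y}` nearest to
`q`. The ball with diameter `qx` meets `{u = u y}` only in `x`, against Hopf's argument. -/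
theorem IsEllipticOn.eventually_eq_of_isMax (hE : IsEllipticOn A b s) (hu : ContDiffOn ℝ ∞ u s)
    (hLu : ∀ z ∈ s, 0 ≤ ellipticOp A b u z) (hy : y ∈ s) (hmax : ∀ z ∈ s, u z ≤ u y) :
    ∀ᶠ z in 𝓝 y, u z = u y := by
  obtain ⟨r, hr0, hr⟩ := Metric.isOpen_iff.1 hE.isOpen y hy
  refine Metric.eventually_nhds_iff.2 ⟨r / 3, by positivity, fun q hq => ?_⟩
  by_contra hne
  have hsub : Metric.closedBall y (2 * r / 3) ⊆ s :=
    (Metric.closedBall_subset_ball (by linarith)).trans hr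
  have hyball := Metric.mem_closedBall_self (x := y) (ε := 2 * r / 3) (by positivity)
  have hK : IsCompact (Metric.closedBall y (2 * r / 3) ∩ u ⁻¹' {u y}) :=
    (isCompact_closedBall _ _).of_isClosed_subset
      ((hu.continuousOn.mono hsub).preimage_isClosed_of_isClosed Metric.isClosed_closedBall
        isClosed_singleton) Set.inter_subset_left
  obtain ⟨x, ⟨hxball, hxu⟩, hxmin⟩ := hK.exists_isMinOn ⟨y, hyball, rfl⟩
    (f := fun z => dist z q) (continuous_id.dist continuous_const).continuousOn
  have hxu : u x = u y := hxu
  have hxy : dist x q ≤ dist y q := hxmin ⟨hyball, rfl⟩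
  have hxq : x ≠ q := fun h => hne (h ▸ hxu)
  have hradius : dist x (midpoint ℝ q x) = dist x q / 2 := by
    rw [dist_right_midpoint (𝕜 := ℝ), Real.norm_two, dist_comm q x]
    ring
  obtain ⟨z, hzs, hzmid, hzx, hzu⟩ := hE.exists_ne_eq_of_isMax hu hLu (q := midpoint ℝ q x)
    (hsub hxball) (dist_pos.1 (hradius ▸ half_pos (dist_pos.2 hxq))) fun z hz => hxu ▸ hmax z hz
  rw [hradius] at hzmid
  refine hzx (eq_of_dist_midpoint_le hzmid (hxmin ⟨?_, hzu.trans hxu⟩))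
  have hzq : dist z q ≤ dist x q := by
    have hmid : dist (midpoint ℝ q x) q = dist x q / 2 := by
      rw [dist_midpoint_left (𝕜 := ℝ), Real.norm_two, dist_comm q x]
      ring
    linarith [dist_triangle z (midpoint ℝ q x) q]
  have htri := dist_triangle z q y
  rw [dist_comm y q] at hxy
  rw [Metric.mem_closedBall]
  linarith

/-- The drift coefficients that turn `Δu - β |∇u|²` into a linear operator applied to `u`; the
second summand, quadratic in `∇u`, is linearised by freezing one factor. -/
def gradientDrift (G : Coord n → Matrix (Fin n) (Fin n) ℝ) (β : ℝ) (u : Coord n → ℝ) (k : Fin n)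
    (z : Coord n) : ℝ :=
  - (∑ i, ∑ j, (G z)⁻¹ i j * christoffel G k i j z) - β * ∑ j, (G z)⁻¹ k j * pd j u z

lemma ellipticOp_gradientDrift (G : Coord n → Matrix (Fin n) (Fin n) ℝ) (β : ℝ)
    (u : Coord n → ℝ) (z : Coord n) :
    ellipticOp (fun z => (G z)⁻¹) (gradientDrift G β u) u z
      = laplacian G u z - β * gradSq G u z := by
  have hΓ : ∑ k, (∑ i, ∑ j, (G z)⁻¹ i j * christoffel G k i j z) * pd k u z
      = ∑ i, ∑ j, (G z)⁻¹ i j * ∑ k, christoffel G k i j z * pd k u z := by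
    simp only [Finset.sum_mul, Finset.mul_sum, mul_assoc]
    exact (sum_sum_sum_comm _).symm
  have hgrad : ∑ k, (∑ j, (G z)⁻¹ k j * pd j u z) * pd k u z = gradSq G u z := by
    simp only [gradSq, Finset.sum_mul]
    exact Finset.sum_congr rfl fun i _ => Finset.sum_congr rfl fun j _ => by ring
  simp only [ellipticOp, gradientDrift, laplacian, hessian, sub_mul, neg_mul, mul_sub, mul_assoc β,
    Finset.sum_sub_distrib, Finset.sum_neg_distrib, ← Finset.mul_sum, hΓ, hgrad]
  ring

lemma IsMetricOn.isEllipticOn (hG : IsMetricOn G s) (hu : ContDiffOn ℝ ∞ u s) (β : ℝ) :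
    IsEllipticOn (fun z => (G z)⁻¹) (gradientDrift G β u) s where
  isOpen := hG.isOpen
  continuousOn_symbol i j := (hG.contDiffOn_inv i j).continuousOn
  posDef z hz := (hG.posDef z hz).inv
  continuousOn_drift k :=
    ((hG.contDiffOn_sum_sum_inv_mul (hG.contDiffOn_christoffel k)).neg.sub
      (contDiffOn_const.mul (ContDiffOn.sum fun j _ => (hG.contDiffOn_inv k j).mul
        (contDiffOn_pd hG.isOpen hu j)))).continuousOn

theorem IsMetricOn.eventually_eq_of_isMax (hG : IsMetricOn G s) (hu : ContDiffOn ℝ ∞ u s) {β : ℝ}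
    (heq : ∀ z ∈ s, laplacian G u z = β * gradSq G u z) (hy : y ∈ s)
    (hmax : ∀ z ∈ s, u z ≤ u y) : ∀ᶠ z in 𝓝 y, u z = u y :=
  (hG.isEllipticOn hu β).eventually_eq_of_isMax hu
    (fun z hz => by rw [ellipticOp_gradientDrift, heq z hz, sub_self]) hy hmax

/-! ### The Ricci tensor of the torsion connection -/

/-- The components `g^{kl} T_{ijl}` of the torsion viewed as a vector-valued 2-form. The torsion
connection and the Levi-Civita connection differ by half of it. -/
def torsionUp (G : Coord n → Matrix (Fin n) (Fin n) ℝ)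
    (τ : Fin n → Fin n → Fin n → Coord n → ℝ) (k i j : Fin n) (y : Coord n) : ℝ :=
  ∑ l, (G y)⁻¹ k l * τ i j l y

lemma IsAlternating.rotate (hτ : IsAlternating τ) (i j k : Fin n) (z : Coord n) :
    τ i j k z = τ k i j z := by
  rw [hτ.swap_right, hτ.swap_left, neg_neg]

lemma IsAlternating.torsionUp_eq (hτ : IsAlternating τ) (k i j : Fin n) :
    torsionUp G τ k i j = fun z => ∑ a, (G z)⁻¹ k a * τ a i j z :=
  funext fun z => Finset.sum_congr rfl fun a _ => by rw [hτ.rotate i j a]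

lemma ricci_add_half_mul {Γ K : Fin n → Fin n → Fin n → Coord n → ℝ}
    (hΓ : ∀ k i j, DifferentiableAt ℝ (Γ k i j) y) (hK : ∀ k i j, DifferentiableAt ℝ (K k i j) y)
    (htr : ∀ k, ∑ i, K i i k y = 0) (hpdtr : ∀ j k, ∑ i, pd j (K i i k) y = 0) (j k : Fin n) :
    ricci (fun k i j z => Γ k i j z + (1 / 2) * K k i j z) j k y = ricci Γ j k y
      + (1 / 2) * (∑ i, pd i (K i j k) y + ∑ i, ∑ m, Γ i i m y * K m j k y
        - ∑ i, ∑ m, Γ i j m y * K m i k y - ∑ i, ∑ m, K i j m y * Γ m i k y)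
      - (1 / 4) * ∑ i, ∑ m, K i j m y * K m i k y := by
  have hpd : ∀ l k i j, pd l (fun z => Γ k i j z + (1 / 2) * K k i j z) y
      = pd l (Γ k i j) y + (1 / 2) * pd l (K k i j) y := fun l k i j => by
    rw [pd_add (hΓ k i j) ((hK k i j).const_mul _), pd_const_mul (hK k i j)]
  have htrace : ∀ X : Fin n → ℝ, ∑ i, ∑ m, K i i m y * X m = 0 := fun X => by
    rw [Finset.sum_comm]
    exact Finset.sum_eq_zero fun m _ => by rw [← Finset.sum_mul, htr, zero_mul]
  have hprod : ∀ a b c d a' b' c' d' : ℝ, (a + 1 / 2 * a') * (b + 1 / 2 * b')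
      - (c + 1 / 2 * c') * (d + 1 / 2 * d') = (a * b - c * d)
        + 1 / 2 * (a * b') + 1 / 2 * (a' * b) + 1 / 4 * (a' * b')
        - 1 / 2 * (c * d') - 1 / 2 * (c' * d) - 1 / 4 * (c' * d') := fun _ _ _ _ _ _ _ _ => by ring
  simp only [ricci, curvature, hpd, hprod, Finset.sum_add_distrib, Finset.sum_sub_distrib,
    ← Finset.mul_sum, htrace, hpdtr]
  ring

namespace IsMetricOn

variable (hG : IsMetricOn G s) (hτ : IsAlternating τ)
include hG

lemma contDiffOn_torsionUp (hτs : ∀ i j k, ContDiffOn ℝ ∞ (τ i j k) s) (k i j : Fin n) :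
    ContDiffOn ℝ ∞ (torsionUp G τ k i j) s :=
  ContDiffOn.sum fun l _ => (hG.contDiffOn_inv k l).mul (hτs i j l)

include hτ

lemma sum_torsionUp_eq_zero (hy : y ∈ s) (k : Fin n) : ∑ i, torsionUp G τ i i k y = 0 :=
  hG.sum_inv_mul_eq_zero_of_antisymm hy fun i m => by
    rw [hτ.rotate i k m, hτ.swap_left, hτ.rotate m k i, hτ.swap_left i m k, neg_neg]

lemma sum_inv_mul_gradInterior (hy : y ∈ s) :
    ∑ i, ∑ j, (G y)⁻¹ i j * gradInterior G τ u i j y = 0 :=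
  hG.sum_inv_mul_eq_zero_of_antisymm hy fun i j => by
    simp only [gradInterior, ← Finset.sum_neg_distrib, ← mul_neg, ← hτ.swap_right _ i j]

lemma sum_torsionUp_mul_torsionUp (hy : y ∈ s) (j k : Fin n) :
    ∑ i, ∑ m, torsionUp G τ i j m y * torsionUp G τ m i k y = torsionSq G τ j k y := by
  simp only [torsionSq, torsionUp, Finset.sum_mul_sum]
  refine Finset.sum_comm.trans (Finset.sum_congr rfl fun m _ => ?_)
  refine (sum_sum_sum_comm _).symm.trans ?_
  refine Finset.sum_congr rfl fun b _ => Finset.sum_congr rfl fun c _ =>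
    Finset.sum_congr rfl fun i _ => ?_
  rw [hG.inv_symm hy i b, ← hτ.rotate k c i]
  ring

lemma sum_pd_torsionUp (hy : y ∈ s) (hτs : ∀ i j k, ContDiffOn ℝ ∞ (τ i j k) s) (j k : Fin n) :
    ∑ i, pd i (torsionUp G τ i j k) y = ∑ i, ∑ a, (G y)⁻¹ i a * pd i (τ a j k) y
      - ∑ i, ∑ m, christoffel G i i m y * torsionUp G τ m j k y
      - ∑ i, ∑ a, (G y)⁻¹ i a * ∑ m, christoffel G m i a y * τ m j k y := by
  have hpd : ∀ i, pd i (torsionUp G τ i j k) y = ∑ a, (G y)⁻¹ i a * pd i (τ a j k) y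
      - ∑ m, christoffel G i i m y * torsionUp G τ m j k y
      - ∑ a, (G y)⁻¹ i a * ∑ m, christoffel G m i a y * τ m j k y := fun i => by
    have hinv : ∑ m, pd i (fun z => (G z)⁻¹ i m) y * τ m j k y
        = - ∑ m, christoffel G i i m y * torsionUp G τ m j k y
          - ∑ a, (G y)⁻¹ i a * ∑ m, christoffel G m i a y * τ m j k y := by
      simp only [hG.pd_inv hy, neg_add', sub_mul, neg_mul, Finset.sum_neg_distrib,
        Finset.sum_sub_distrib, hτ.torsionUp_eq, Finset.sum_mul, Finset.mul_sum, mul_assoc]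
      rw [Finset.sum_comm]
      congr 1
      rw [Finset.sum_comm]
      exact Finset.sum_congr rfl fun m _ => Finset.sum_congr rfl fun a _ => by ring
    rw [hτ.torsionUp_eq, hG.pd_sum_inv_mul hy (fun a => hG.differentiableAt hy (hτs a j k)), hinv]
    ring
  simp only [hpd, Finset.sum_sub_distrib]

lemma codiff_eq_neg_sum_pd_torsionUp (hy : y ∈ s) (hτs : ∀ i j k, ContDiffOn ℝ ∞ (τ i j k) s)
    (j k : Fin n) : codiff G τ j k y = - (∑ i, pd i (torsionUp G τ i j k) y
      + ∑ i, ∑ m, christoffel G i i m y * torsionUp G τ m j k y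
      - ∑ i, ∑ m, christoffel G i j m y * torsionUp G τ m i k y
      - ∑ i, ∑ m, torsionUp G τ i j m y * christoffel G m i k y) := by
  have hleft : ∑ i, ∑ m, christoffel G i j m y * torsionUp G τ m i k y
      = ∑ i, ∑ a, (G y)⁻¹ i a * ∑ m, christoffel G m i j y * τ a m k y := by
    simp only [hτ.torsionUp_eq, Finset.mul_sum]
    rw [Finset.sum_comm]
    refine Finset.sum_congr rfl fun i _ => Finset.sum_comm.trans ?_
    refine Finset.sum_congr rfl fun a _ => Finset.sum_congr rfl fun m _ => ?_
    rw [hG.christoffel_symm hy m j i, mul_left_comm]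
  have hright : ∑ i, ∑ m, torsionUp G τ i j m y * christoffel G m i k y
      = ∑ i, ∑ a, (G y)⁻¹ i a * ∑ m, christoffel G m i k y * τ a j m y := by
    simp only [hτ.torsionUp_eq, Finset.mul_sum, Finset.sum_mul]
    refine Finset.sum_congr rfl fun i _ => Finset.sum_comm.trans ?_
    exact Finset.sum_congr rfl fun a _ => Finset.sum_congr rfl fun m _ => by ring
  rw [hG.sum_pd_torsionUp hτ hy hτs, hleft, hright]
  simp only [codiff, covDeriv, mul_sub, mul_add, Finset.sum_add_distrib, Finset.sum_sub_distrib]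
  ring

theorem ricci_torsionCoeff (hy : y ∈ s) (hτs : ∀ i j k, ContDiffOn ℝ ∞ (τ i j k) s)
    (j k : Fin n) : ricci (torsionCoeff G τ) j k y = ricci (christoffel G) j k y
      - (1 / 4) * torsionSq G τ j k y - (1 / 2) * codiff G τ j k y := by
  have hK : ∀ k i j, DifferentiableAt ℝ (torsionUp G τ k i j) y := fun k i j =>
    hG.differentiableAt hy (hG.contDiffOn_torsionUp hτs k i j)
  have hpdtr : ∀ j k, ∑ i, pd j (torsionUp G τ i i k) y = 0 := fun j k => by
    rw [← pd_sum _ fun i => hK i i k,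
      pd_congr hG.isOpen (fun z hz => hG.sum_torsionUp_eq_zero hτ hz k) hy, pd_const]
  refine (ricci_add_half_mul (fun k i j => hG.differentiableAt hy (hG.contDiffOn_christoffel k i j))
    hK (hG.sum_torsionUp_eq_zero hτ hy) hpdtr j k).trans ?_
  rw [hG.sum_torsionUp_mul_torsionUp hτ hy, hG.codiff_eq_neg_sum_pd_torsionUp hτ hy hτs]
  ring

end IsMetricOn

namespace IsSolitonOn

variable (hS : IsSolitonOn G τ u s) (hy : y ∈ s)
include hS hy

lemma scalarCurvature_eq : scalarCurvature G y = (1 / 4) * normSq G τ y - laplacian G u y := by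
  simp only [scalarCurvature, hS.ricci_eq y hy, normSq, laplacian, Finset.mul_sum,
    ← Finset.sum_sub_distrib]
  exact Finset.sum_congr rfl fun i _ => Finset.sum_congr rfl fun j _ => by ring

lemma ricci_torsionCoeff (i j : Fin n) : ricci (torsionCoeff G τ) i j y
    = - hessian G u i j y + (1 / 2) * gradInterior G τ u i j y := by
  rw [hS.isMetricOn.ricci_torsionCoeff hS.isAlternating hy hS.contDiffOn_form, hS.ricci_eq y hy,
    hS.codiff_eq y hy]
  ring

lemma laplacian_eq_zero_of_ricci_torsionCoeff (h : ∀ i j, ricci (torsionCoeff G τ) i j y = 0) :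
    laplacian G u y = 0 := by
  have hhess : ∀ i j, hessian G u i j y = (1 / 2) * gradInterior G τ u i j y := fun i j => by
    linarith [h i j, hS.ricci_torsionCoeff hy i j]
  simp only [laplacian, hhess, mul_left_comm _ (1 / 2 : ℝ), ← Finset.mul_sum]
  rw [hS.isMetricOn.sum_inv_mul_gradInterior hS.isAlternating hy, mul_zero]

end IsSolitonOn

/-! ### Tensor fields in charts -/

section Overlap

variable {M : Type*} [TopologicalSpace M] {φ φ' : OpenPartialHomeomorph M (Coord n)}

/-- The domain of the change of coordinates `φ ∘ φ'⁻¹`. -/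
def overlap (φ φ' : OpenPartialHomeomorph M (Coord n)) : Set (Coord n) :=
  φ'.target ∩ φ'.symm ⁻¹' φ.source

lemma isOpen_overlap (φ φ' : OpenPartialHomeomorph M (Coord n)) : IsOpen (overlap φ φ') :=
  φ'.isOpen_inter_preimage_symm φ.open_source

lemma overlap_swap_mem {z : Coord n} (hz : z ∈ overlap φ φ') : φ (φ'.symm z) ∈ overlap φ' φ :=
  ⟨φ.map_source hz.2, by rw [Set.mem_preimage, φ.left_inv hz.2]; exact φ'.map_target hz.1⟩

end Overlap

section Multilinear

variable {ι E : Type*} [Fintype ι] [NormedAddCommGroup E] [NormedSpace ℝ E]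

lemma bilinear_sum_smul (B : E →L[ℝ] E →L[ℝ] ℝ) (c d : ι → ℝ) (v : ι → E) :
    B (∑ a, c a • v a) (∑ b, d b • v b) = ∑ a, ∑ b, c a * d b * B (v a) (v b) := by
  simp only [map_sum, map_smul, sum_apply, smul_apply, smul_eq_mul, Finset.mul_sum]
  rw [Finset.sum_comm]
  exact Finset.sum_congr rfl fun _ _ => Finset.sum_congr rfl fun _ _ => by ring

lemma trilinear_sum_smul (B : E [⋀^Fin 3]→L[ℝ] ℝ) (c d e : ι → ℝ) (v : ι → E) :
    B ![∑ a, c a • v a, ∑ a, d a • v a, ∑ a, e a • v a] =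
      ∑ a, ∑ b, ∑ k, c a * d b * e k * B ![v a, v b, v k] := by
  have hslot : ∀ (m : Fin 3 → E) (i : Fin 3) (x : ι → ℝ),
      B (Function.update m i (∑ a, x a • v a)) = ∑ a, x a * B (Function.update m i (v a)) :=
    fun m i x => (B.toMultilinearMap.map_update_sum _ _ _ _).trans <|
      Finset.sum_congr rfl fun a _ => B.toMultilinearMap.map_update_smul _ _ _ _
  have hupdate : ∀ p q r x : E, Function.update ![p, q, r] 0 x = ![x, q, r] ∧
      Function.update ![p, q, r] 1 x = ![p, x, r] ∧
      Function.update ![p, q, r] 2 x = ![p, q, x] := fun p q r x => by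
    refine ⟨?_, ?_, ?_⟩ <;> (funext k; fin_cases k <;> rfl)
  have h0 : ∀ q r, B ![∑ a, c a • v a, q, r] = ∑ a, c a * B ![v a, q, r] := fun q r => by
    simpa only [(hupdate 0 q r _).1] using hslot ![0, q, r] 0 c
  have h1 : ∀ p r, B ![p, ∑ a, d a • v a, r] = ∑ a, d a * B ![p, v a, r] := fun p r => by
    simpa only [(hupdate p 0 r _).2.1] using hslot ![p, 0, r] 1 d
  have h2 : ∀ p q, B ![p, q, ∑ a, e a • v a] = ∑ a, e a * B ![p, q, v a] := fun p q => by
    simpa only [(hupdate p q 0 _).2.2] using hslot ![p, q, 0] 2 e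
  simp only [h0, h1, h2, Finset.mul_sum, mul_assoc]

end Multilinear

section Charts

variable {M : Type*} [TopologicalSpace M] [ChartedSpace (Coord n) M]
  {φ φ' : OpenPartialHomeomorph M (Coord n)} {z : Coord n}

/-- The coordinate vector field `∂_i` of a chart at the point with coordinates `y`. Its values are
taken in the model space, with which Mathlib identifies each tangent space by definition, so that
frames at points which are only propositionally equal can be compared. -/
def coordFrame (φ : OpenPartialHomeomorph M (Coord n)) (y : Coord n) (i : Fin n) : Coord n :=
  chartDiff φ y (basisVec i)

/-- A 3-form at a point, as an alternating map on the model space. -/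
def formAt (T : ThreeForm n M) (x : M) : Coord n [⋀^Fin 3]→L[ℝ] ℝ := T x

lemma components_eq_formAt (T : ThreeForm n M) (φ : OpenPartialHomeomorph M (Coord n))
    (i j k : Fin n) (y : Coord n) : components T φ i j k y =
      formAt T (φ.symm y) ![coordFrame φ y i, coordFrame φ y j, coordFrame φ y k] := by
  refine congrArg (formAt T (φ.symm y)) (funext fun a => ?_)
  fin_cases a <;> rfl

lemma isAlternating_components (T : ThreeForm n M) (φ : OpenPartialHomeomorph M (Coord n)) :
    IsAlternating (components T φ) where
  swap_left i j k z := by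
    refine Eq.trans (congrArg (localForm T φ z) (funext fun a => ?_))
      ((localForm T φ z).toAlternatingMap.map_swap
        ![basisVec j, basisVec i, basisVec k] (i := 0) (j := 1) (by decide))
    fin_cases a <;> rfl
  swap_right i j k z := by
    refine Eq.trans (congrArg (localForm T φ z) (funext fun a => ?_))
      ((localForm T φ z).toAlternatingMap.map_swap
        ![basisVec i, basisVec k, basisVec j] (i := 1) (j := 2) (by decide))
    fin_cases a <;> rfl

lemma IsSmooth.contDiffOn_components {T : ThreeForm n M} (hT : IsSmooth T) (hφ : IsChart φ)
    (i j k : Fin n) : ContDiffOn ℝ ∞ (components T φ i j k) φ.target :=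
  (ContinuousAlternatingMap.apply ℝ (Coord n) ℝ
    ![basisVec i, basisVec j, basisVec k]).contDiff.comp_contDiffOn (hT φ hφ)

lemma IsClosedForm.isClosedAt {T : ThreeForm n M} (h : IsClosedForm T) (hT : IsSmooth T)
    (hφ : IsChart φ) (hy : y ∈ φ.target) : IsClosedAt (components T φ) y := by
  intro i j a b
  set e : Fin n → Coord n := basisVec
  have hd : DifferentiableAt ℝ (localForm T φ) y :=
    ((hT φ hφ).contDiffAt (φ.open_target.mem_nhds hy)).differentiableAt (by simp)
  have hremove : (0 : Fin 4).removeNth ![e i, e j, e a, e b] = ![e j, e a, e b] ∧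
      (1 : Fin 4).removeNth ![e i, e j, e a, e b] = ![e i, e a, e b] ∧
      (2 : Fin 4).removeNth ![e i, e j, e a, e b] = ![e i, e j, e b] ∧
      (3 : Fin 4).removeNth ![e i, e j, e a, e b] = ![e i, e j, e a] := by
    refine ⟨?_, ?_, ?_, ?_⟩ <;> (funext k; fin_cases k <;> rfl)
  obtain ⟨h0, h1, h2, h3⟩ := hremove
  have hsum := extDeriv_apply hd ![e i, e j, e a, e b]
  rw [h φ hφ y hy, Fin.sum_univ_four, h0, h1, h2, h3] at hsum
  have hpd : (0 : ℝ) = (-1) ^ 0 • pd i (components T φ j a b) y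
      + (-1) ^ 1 • pd j (components T φ i a b) y + (-1) ^ 2 • pd a (components T φ i j b) y
      + (-1) ^ 3 • pd b (components T φ i j a) y := hsum
  simp only [zsmul_eq_mul, Int.cast_pow, Int.cast_neg, Int.cast_one] at hpd
  linarith

lemma contDiffOn_comp_symm {f : M → ℝ} (hf : ContMDiff (𝓡 n) 𝓘(ℝ, ℝ) ∞ f) (hφ : IsChart φ) :
    ContDiffOn ℝ ∞ (f ∘ φ.symm) φ.target :=
  contMDiffOn_iff_contDiffOn.1 (hf.comp_contMDiffOn (contMDiffOn_symm_of_mem_maximalAtlas hφ))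

namespace IsChart

variable (hφ : IsChart φ) (hφ' : IsChart φ')
include hφ

lemma contMDiffOn : ContMDiffOn (𝓡 n) (𝓡 n) ∞ φ φ.source :=
  contMDiffOn_of_mem_maximalAtlas hφ

lemma contMDiffOn_symm : ContMDiffOn (𝓡 n) (𝓡 n) ∞ φ.symm φ.target :=
  contMDiffOn_symm_of_mem_maximalAtlas hφ

lemma mdifferentiableAt {x : M} (hx : x ∈ φ.source) : MDifferentiableAt (𝓡 n) (𝓡 n) φ x :=
  (hφ.contMDiffOn.contMDiffAt (φ.open_source.mem_nhds hx)).mdifferentiableAt (by simp)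

lemma mdifferentiableAt_symm (hy : y ∈ φ.target) : MDifferentiableAt (𝓡 n) (𝓡 n) φ.symm y :=
  (hφ.contMDiffOn_symm.contMDiffAt (φ.open_target.mem_nhds hy)).mdifferentiableAt (by simp)

lemma linearIndependent_coordFrame (hy : y ∈ φ.target) :
    LinearIndependent ℝ (coordFrame φ y) := by
  have hcomp : (mfderiv (𝓡 n) (𝓡 n) φ (φ.symm y)).comp (chartDiff φ y) =
      ContinuousLinearMap.id ℝ (Coord n) := by
    have hid : φ ∘ φ.symm =ᶠ[𝓝 y] id := by
      filter_upwards [φ.open_target.mem_nhds hy] with w hw using φ.right_inv hw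
    have hchain := mfderiv_comp y (hφ.mdifferentiableAt (φ.map_target hy))
      (hφ.mdifferentiableAt_symm hy)
    rw [hid.mfderiv_eq, mfderiv_id] at hchain
    exact hchain.symm
  have hbasis : LinearIndependent ℝ (basisVec : Fin n → Coord n) :=
    EuclideanSpace.orthonormal_single.linearIndependent
  let L : Coord n →L[ℝ] Coord n := mfderiv (𝓡 n) (𝓡 n) φ (φ.symm y)
  have hL : L ∘ coordFrame φ y = basisVec :=
    funext fun i => congrArg (fun A => A (basisVec i)) hcomp
  exact LinearIndependent.of_comp L.toLinearMap (hL ▸ hbasis)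

section Transition

include hφ'

lemma contDiffOn_transition : ContDiffOn ℝ ∞ (fun z => φ (φ'.symm z)) (overlap φ φ') :=
  contMDiffOn_iff_contDiffOn.1 <| hφ.contMDiffOn.comp
    (hφ'.contMDiffOn_symm.mono Set.inter_subset_left) fun _ hz => hz.2

lemma coordFrame_transition (hz : z ∈ overlap φ φ') (i : Fin n) : coordFrame φ' z i =
    ∑ a, jacobian (fun z => φ (φ'.symm z)) a i z • coordFrame φ (φ (φ'.symm z)) a := by
  set ψ : Coord n → Coord n := fun z => φ (φ'.symm z)
  have hd : DifferentiableAt ℝ ψ z :=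
    ((hφ.contDiffOn_transition hφ').contDiffAt
      ((isOpen_overlap φ φ').mem_nhds hz)).differentiableAt (by simp)
  have hψ : φ'.symm =ᶠ[𝓝 z] φ.symm ∘ ψ := by
    filter_upwards [(isOpen_overlap φ φ').mem_nhds hz] with w hw
    exact (φ.left_inv hw.2).symm
  have hchain := mfderiv_comp z (I := 𝓡 n) (I' := 𝓡 n) (I'' := 𝓡 n) (f := ψ)
    (hφ.mdifferentiableAt_symm (φ.map_source hz.2)) hd.mdifferentiableAt
  have hfderiv : fderiv ℝ ψ z (basisVec i) = ∑ a, jacobian ψ a i z • basisVec a := by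
    ext j
    simp [jacobian_eq_fderiv hd, basisVec, Pi.single_apply]
  rw [← hψ.mfderiv_eq, mfderiv_eq_fderiv] at hchain
  let L : Coord n →L[ℝ] Coord n := chartDiff φ (ψ z)
  calc coordFrame φ' z i
      = L (fderiv ℝ ψ z (basisVec i)) :=
        congrArg (fun L : Coord n →L[ℝ] Coord n => L (basisVec i)) hchain
    _ = ∑ a, jacobian ψ a i z • L (basisVec a) := by simp only [hfderiv, map_sum, map_smul]

lemma components_transition (T : ThreeForm n M) (hz : z ∈ overlap φ φ') (i j k : Fin n) :
    components T φ' i j k z = ∑ a, ∑ b, ∑ c, jacobian (fun z => φ (φ'.symm z)) a i z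
      * jacobian (fun z => φ (φ'.symm z)) b j z * jacobian (fun z => φ (φ'.symm z)) c k z
      * components T φ a b c (φ (φ'.symm z)) := by
  simp only [components_eq_formAt, hφ.coordFrame_transition hφ' hz, trilinear_sum_smul,
    φ.left_inv hz.2]

end Transition

variable [IsManifold (𝓡 n) ∞ M]

lemma contMDiffOn_chartDiff (v : Coord n) : ContMDiffOn (𝓡 n) (𝓡 n).tangent ∞
    (fun y => (⟨φ.symm y, chartDiff φ y v⟩ : TangentBundle (𝓡 n) M)) φ.target := by
  have hconst : ContMDiffOn (𝓡 n) (𝓡 n).tangent ∞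
      (fun y : Coord n => (⟨y, v⟩ : TangentBundle (𝓡 n) (Coord n))) φ.target := fun y _ =>
    contMDiffWithinAt_vectorSpace_iff_contDiffWithinAt.2 contDiffWithinAt_const
  have htangent := hφ.contMDiffOn_symm.contMDiffOn_tangentMapWithin (m := ∞) (by simp)
    φ.open_target.uniqueMDiffOn
  refine (htangent.comp hconst fun y hy => hy).congr fun y hy => ?_
  simp only [Function.comp, tangentMapWithin, mfderivWithin_of_isOpen φ.open_target hy]
  rfl

end IsChart

variable [IsManifold (𝓡 n) ∞ M]

/-- A metric at a point, as a bilinear form on the model space. -/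
def innerAt (g : Metric n M) (x : M) : Coord n →L[ℝ] Coord n →L[ℝ] ℝ := g.inner x

lemma localMetric_eq_innerAt (g : Metric n M) (φ : OpenPartialHomeomorph M (Coord n))
    (y : Coord n) (i j : Fin n) :
    localMetric g φ y i j = innerAt g (φ.symm y) (coordFrame φ y i) (coordFrame φ y j) := rfl

namespace IsChart

variable (hφ : IsChart φ) (g : Metric n M)
include hφ

lemma localMetric_transition (hφ' : IsChart φ') (hz : z ∈ overlap φ φ') (i j : Fin n) :
    localMetric g φ' z i j = ∑ a, ∑ b, jacobian (fun z => φ (φ'.symm z)) a i z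
      * jacobian (fun z => φ (φ'.symm z)) b j z * localMetric g φ (φ (φ'.symm z)) a b := by
  simp only [localMetric_eq_innerAt, hφ.coordFrame_transition hφ' hz, bilinear_sum_smul,
    φ.left_inv hz.2]

lemma contDiffOn_localMetric (i j : Fin n) :
    ContDiffOn ℝ ∞ (fun y => localMetric g φ y i j) φ.target := by
  refine contMDiffOn_iff_contDiffOn.1 fun y hy => ?_
  have hinner : ContMDiffWithinAt (𝓡 n) ((𝓡 n).prod 𝓘(ℝ)) ∞
      (fun y ↦ Bundle.TotalSpace.mk' ℝ (E := Bundle.Trivial M ℝ) (φ.symm y)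
        (g.inner (φ.symm y) (chartDiff φ y (basisVec i)) (chartDiff φ y (basisVec j))))
      φ.target y :=
    ContMDiffWithinAt.clm_bundle_apply₂ (F₁ := Coord n) (F₂ := Coord n)
      (g.contMDiff.contMDiffAt.comp_contMDiffWithinAt y (hφ.contMDiffOn_symm y hy))
      (hφ.contMDiffOn_chartDiff (basisVec i) y hy) (hφ.contMDiffOn_chartDiff (basisVec j) y hy)
  simp only [Bundle.contMDiffWithinAt_totalSpace] at hinner
  exact hinner.2

lemma posDef_localMetric (hy : y ∈ φ.target) : (localMetric g φ y).PosDef := by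
  rw [Matrix.posDef_iff_dotProduct_mulVec]
  refine ⟨Matrix.IsHermitian.ext fun i j => g.symm _ _ _, fun v hv => ?_⟩
  have hne : ∑ i, v i • coordFrame φ y i ≠ 0 := fun h =>
    hv (funext (Fintype.linearIndependent_iff.1 (hφ.linearIndependent_coordFrame hy) v h))
  have hpos : 0 < innerAt g (φ.symm y) (∑ i, v i • coordFrame φ y i)
      (∑ i, v i • coordFrame φ y i) := g.pos _ _ hne
  rw [bilinear_sum_smul] at hpos
  refine hpos.trans_eq ?_
  simp only [dotProduct, Matrix.mulVec, star_trivial, Finset.mul_sum, localMetric_eq_innerAt]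
  exact Finset.sum_congr rfl fun i _ => Finset.sum_congr rfl fun j _ => by ring

lemma isMetricOn : IsMetricOn (localMetric g φ) φ.target where
  isOpen := φ.open_target
  contDiffOn i j := hφ.contDiffOn_localMetric g i j
  posDef _ hz := hφ.posDef_localMetric g hz

lemma isIsometryOn (hφ' : IsChart φ') :
    IsIsometryOn (fun z => φ (φ'.symm z)) (localMetric g φ') (overlap φ φ')
      (localMetric g φ) φ.target where
  source :=
    { isOpen := isOpen_overlap φ φ'
      contDiffOn := fun i j => (hφ'.contDiffOn_localMetric g i j).mono Set.inter_subset_left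
      posDef := fun _ hz => hφ'.posDef_localMetric g hz.1 }
  target := hφ.isMetricOn g
  contDiffOn := hφ.contDiffOn_transition hφ'
  mapsTo _ hz := φ.map_source hz.2
  metric_eq _ hz i j := hφ.localMetric_transition g hφ' hz i j

lemma isSolitonOn {T : ThreeForm n M} {f : M → ℝ} (hT : IsSmooth T)
    (hf : ContMDiff (𝓡 n) 𝓘(ℝ, ℝ) ∞ f) (hsol : IsGradientSoliton g T f) :
    IsSolitonOn (localMetric g φ) (components T φ) (f ∘ φ.symm) φ.target where
  isMetricOn := hφ.isMetricOn g
  contDiffOn_form i j k := hT.contDiffOn_components hφ i j k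
  contDiffOn_potential := contDiffOn_comp_symm hf hφ
  isAlternating := isAlternating_components T φ
  isClosedAt _ hz := hsol.closed.isClosedAt hT hφ hz
  ricci_eq z hz i j := hsol.ricci_eq φ hφ z hz i j
  codiff_eq z hz i j := hsol.codiff_eq φ hφ z hz i j

end IsChart

end Charts

/-! ### Normal coordinates -/

section InverseFunction

variable {E : Type*} [NormedAddCommGroup E] [NormedSpace ℝ E] [FiniteDimensional ℝ E]

/-- The source is shrunk to the points with invertible derivative, so that the inverse is smooth
on the whole target. -/
lemma exists_openPartialHomeomorph_of_det_fderiv_ne_zero {ψ : E → E} (hψ : ContDiff ℝ ∞ ψ) {z : E}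
    (hz : (fderiv ℝ ψ z).det ≠ 0) : ∃ e : OpenPartialHomeomorph E E,
      z ∈ e.source ∧ (e : E → E) = ψ ∧ ContDiffOn ℝ ∞ e.symm e.target := by
  have : CompleteSpace E := FiniteDimensional.complete ℝ E
  have hderiv : ∀ w (hw : (fderiv ℝ ψ w).det ≠ 0), HasFDerivAt ψ
      ((fderiv ℝ ψ w).toContinuousLinearEquivOfDetNeZero hw : E →L[ℝ] E) w := fun w hw => by
    rw [ContinuousLinearMap.coe_toContinuousLinearEquivOfDetNeZero]
    exact (hψ.differentiable (by simp) w).hasFDerivAt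
  have hopen : IsOpen {w | (fderiv ℝ ψ w).det ≠ 0} :=
    isOpen_ne_fun (ContinuousLinearMap.continuous_det.comp (hψ.continuous_fderiv (by simp)))
      continuous_const
  set e := (hψ.contDiffAt.toOpenPartialHomeomorph ψ (hderiv z hz) (by simp)).restrOpen _ hopen
  refine ⟨e, ⟨hψ.contDiffAt.mem_toOpenPartialHomeomorph_source (hderiv z hz) (by simp), hz⟩, rfl,
    fun w hw => ?_⟩
  exact (e.contDiffAt_symm hw (hderiv _ (e.map_target hw).2)
    hψ.contDiffAt).contDiffWithinAt

end InverseFunction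

lemma det_fderiv_eq_det_jacobian {ψ : Coord n → Coord n} (hψ : DifferentiableAt ℝ ψ y) :
    (fderiv ℝ ψ y).det = (Matrix.of fun a i => jacobian ψ a i y).det := by
  rw [ContinuousLinearMap.det,
    ← LinearMap.det_toMatrix (EuclideanSpace.basisFun (Fin n) ℝ).toBasis]
  congr 1
  ext a i
  simp [LinearMap.toMatrix_apply, jacobian_eq_fderiv hψ, basisVec]

lemma exists_transpose_mul_mul_eq_one {ι : Type*} [Fintype ι] [DecidableEq ι]
    {A : Matrix ι ι ℝ} (hA : A.PosDef) :
    ∃ P : Matrix ι ι ℝ, P.det ≠ 0 ∧ P.transpose * A * P = 1 := by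
  open scoped MatrixOrder in
  obtain ⟨B, hB⟩ := CStarAlgebra.nonneg_iff_eq_star_mul_self.mp hA.posSemidef.nonneg
  rw [Matrix.star_eq_conjTranspose, Matrix.conjTranspose_eq_transpose_of_trivial] at hB
  have hdet : IsUnit B.det := by
    have hA := hA.det_pos.ne'
    rw [hB, Matrix.det_mul] at hA
    exact (right_ne_zero_of_mul hA).isUnit
  refine ⟨B⁻¹, (Matrix.isUnit_nonsing_inv_det B hdet).ne_zero, ?_⟩
  rw [hB, ← Matrix.mul_assoc, ← Matrix.transpose_mul, Matrix.mul_nonsing_inv _ hdet,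
    Matrix.transpose_one, Matrix.one_mul, Matrix.mul_nonsing_inv _ hdet]

section QuadraticMap

/-- The map `z ↦ y + P z - ½ Γ(z, z)`, a quadratic change of coordinates with prescribed value and
derivatives at the origin. -/
def quadraticMap (y : Coord n) (P : Matrix (Fin n) (Fin n) ℝ) (Γ : Fin n → Fin n → Fin n → ℝ)
    (z : Coord n) : Coord n :=
  WithLp.toLp 2 fun a => y a + ∑ i, P a i * z i - ∑ i, ∑ j, (1 / 2) * Γ a i j * (z i * z j)

variable {z : Coord n} {P : Matrix (Fin n) (Fin n) ℝ} {Γ : Fin n → Fin n → Fin n → ℝ}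

lemma quadraticMap_zero : quadraticMap y P Γ 0 = y := by
  ext a
  simp [quadraticMap]

lemma contDiff_quadraticMap : ContDiff ℝ ∞ (quadraticMap y P Γ) := by
  have := contDiff_coord (n := n)
  refine contDiff_euclidean.2 fun a => ?_
  unfold quadraticMap
  simp only
  fun_prop

variable (hΓ : ∀ a i j, Γ a i j = Γ a j i)
include hΓ

lemma jacobian_quadraticMap (a i : Fin n) :
    jacobian (quadraticMap y P Γ) a i z = P a i - ∑ j, Γ a i j * z j := by
  have hcoord : ∀ k : Fin n, DifferentiableAt ℝ (fun z : Coord n => z k) z := fun k =>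
    (contDiff_coord k).differentiable (by simp) z
  have hlin : ∀ k, DifferentiableAt ℝ (fun z : Coord n => P a k * z k) z := fun k =>
    (hcoord k).const_mul _
  have hquad : ∀ k l, DifferentiableAt ℝ
      (fun z : Coord n => (1 / 2) * Γ a k l * (z k * z l)) z := fun k l =>
    ((hcoord k).fun_mul (hcoord l)).const_mul _
  have hpdlin : pd i (fun z => ∑ k, P a k * z k) z = P a i := by
    simp only [pd_sum _ hlin, fun k => pd_const_mul (hcoord k) (P a k) i, pd_coord]
    simp
  have hpdquad : pd i (fun z => ∑ k, ∑ l, (1 / 2) * Γ a k l * (z k * z l)) z =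
      ∑ j, Γ a i j * z j := by
    simp only [pd_sum _ fun k => DifferentiableAt.fun_sum fun l _ => hquad k l,
      fun k => pd_sum Finset.univ (hquad k) i,
      fun k l => pd_const_mul ((hcoord k).fun_mul (hcoord l)) (1 / 2 * Γ a k l) i,
      fun k l => pd_mul (hcoord k) (hcoord l) i, pd_coord, mul_add, Finset.sum_add_distrib,
      ite_mul, one_mul, zero_mul, mul_ite, mul_one, mul_zero, Finset.sum_ite_eq',
      Finset.mem_univ, if_true]
    rw [Finset.sum_comm]
    simp only [Finset.sum_ite_eq', Finset.mem_univ, if_true, ← Finset.sum_add_distrib]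
    exact Finset.sum_congr rfl fun j _ => by rw [hΓ a j i]; ring
  change pd i (fun z => y a + ∑ i, P a i * z i - ∑ i, ∑ j, (1 / 2) * Γ a i j * (z i * z j)) z = _
  rw [pd_sub ((differentiableAt_const _).fun_add (DifferentiableAt.fun_sum fun k _ => hlin k))
      (DifferentiableAt.fun_sum fun k _ => DifferentiableAt.fun_sum fun l _ => hquad k l),
    pd_add (differentiableAt_const _) (DifferentiableAt.fun_sum fun k _ => hlin k), pd_const,
    zero_add, hpdlin, hpdquad]

lemma jacobian_quadraticMap_zero (a i : Fin n) :
    jacobian (quadraticMap y P Γ) a i 0 = P a i := by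
  simp [jacobian_quadraticMap hΓ]

lemma pd_jacobian_quadraticMap (a i j : Fin n) :
    pd i (jacobian (quadraticMap y P Γ) a j) z = - Γ a i j := by
  have hcoord : ∀ k : Fin n, DifferentiableAt ℝ (fun z : Coord n => z k) z := fun k =>
    (contDiff_coord k).differentiable (by simp) z
  rw [show jacobian (quadraticMap y P Γ) a j = fun z => P a j - ∑ k, Γ a j k * z k from
    funext fun z => jacobian_quadraticMap hΓ a j,
    pd_sub (differentiableAt_const _) (DifferentiableAt.fun_sum fun k _ => (hcoord k).const_mul _),
    pd_const, pd_sum _ fun k => (hcoord k).const_mul _]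
  simp only [fun k => pd_const_mul (hcoord k) (Γ a j k) i, pd_coord]
  simp [hΓ a i j]

end QuadraticMap

/-- The quadratic map with differential `P` at the origin whose second derivatives cancel the
Christoffel symbols of `G` at `y`. -/
def normalMap (G : Coord n → Matrix (Fin n) (Fin n) ℝ) (y : Coord n)
    (P : Matrix (Fin n) (Fin n) ℝ) : Coord n → Coord n :=
  quadraticMap y P fun e i j => ∑ a, ∑ b, P a i * P b j * christoffel G e a b y

lemma IsMetricOn.sum_sum_mul_christoffel_symm (hG : IsMetricOn G s) (hy : y ∈ s)
    (P : Matrix (Fin n) (Fin n) ℝ) (e i j : Fin n) :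
    ∑ a, ∑ b, P a i * P b j * christoffel G e a b y =
      ∑ a, ∑ b, P a j * P b i * christoffel G e a b y := by
  rw [Finset.sum_comm]
  simp only [hG.christoffel_symm hy e, mul_comm (P _ i)]

lemma IsMetricOn.exists_openPartialHomeomorph_eq_normalMap (hG : IsMetricOn G s) (hy : y ∈ s)
    {P : Matrix (Fin n) (Fin n) ℝ} (hP : P.det ≠ 0) :
    ∃ e : OpenPartialHomeomorph (Coord n) (Coord n), 0 ∈ e.source ∧
      (e : Coord n → Coord n) = normalMap G y P ∧ ContDiffOn ℝ ∞ e.symm e.target := by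
  refine exists_openPartialHomeomorph_of_det_fderiv_ne_zero contDiff_quadraticMap ?_
  rw [det_fderiv_eq_det_jacobian (contDiff_quadraticMap.differentiable (by simp) 0)]
  simp only [jacobian_quadraticMap_zero (hG.sum_sum_mul_christoffel_symm hy P)]
  exact hP

lemma IsIsometryOn.isNormalAt_of_eqOn_normalMap {ψ : Coord n → Coord n}
    {G' : Coord n → Matrix (Fin n) (Fin n) ℝ} {s' : Set (Coord n)} {P : Matrix (Fin n) (Fin n) ℝ}
    (h : IsIsometryOn ψ G' s' G s) (hy : y ∈ s) (hP : P.transpose * G y * P = 1)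
    (h0 : 0 ∈ s') (hψ : Set.EqOn ψ (normalMap G y P) s') : IsNormalAt G' 0 := by
  have hΓ := h.target.sum_sum_mul_christoffel_symm hy P
  have hψ0 : ψ 0 = y := (hψ h0).trans quadraticMap_zero
  have hJ : ∀ a i, Set.EqOn (jacobian ψ a i) (jacobian (normalMap G y P) a i) s' :=
    fun a i z hz => pd_congr h.source.isOpen (fun w hw => congrArg (· a) (hψ hw)) hz i
  have hJ0 : ∀ a i, jacobian ψ a i 0 = P a i := fun a i =>
    (hJ a i h0).trans (jacobian_quadraticMap_zero hΓ a i)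
  refine h.isNormalAt h0 ?_ fun e i j => ?_
  · ext i j
    simp only [h.metric_eq 0 h0, hJ0, hψ0, ← hP, Matrix.mul_apply, Matrix.transpose_apply,
      Finset.sum_mul]
    rw [Finset.sum_comm]
    simp only [mul_right_comm]
  · rw [covJacobian, pd_congr h.source.isOpen (hJ e j) h0, normalMap,
      pd_jacobian_quadraticMap hΓ]
    simp only [hJ0, hψ0, neg_add_cancel]

section NormalChart

variable {M : Type*} [TopologicalSpace M] {φ : OpenPartialHomeomorph M (Coord n)}
  {e : OpenPartialHomeomorph (Coord n) (Coord n)}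

lemma mem_overlap_trans_symm {z : Coord n} (hz : z ∈ e.source) (hez : e z ∈ φ.target) :
    z ∈ overlap φ (φ.trans e.symm) :=
  ⟨⟨hz, hez⟩, φ.map_target hez⟩

lemma eqOn_transition_trans_symm :
    Set.EqOn (fun z => φ ((φ.trans e.symm).symm z)) e (overlap φ (φ.trans e.symm)) :=
  fun _ hz => φ.right_inv hz.1.2

variable [ChartedSpace (Coord n) M] [IsManifold (𝓡 n) ∞ M]

lemma IsChart.trans_symm (hφ : IsChart φ) (he : ContDiffOn ℝ ∞ e e.source)
    (he' : ContDiffOn ℝ ∞ e.symm e.target) : IsChart (φ.trans e.symm) := by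
  refine OpenPartialHomeomorph.mem_maximalAtlas_of_contMDiffOn _ ?_ ?_
  · exact (contMDiffOn_iff_contDiffOn.2 he').comp
      (hφ.contMDiffOn.mono fun _ hx => hx.1) fun _ hx => hx.2
  · exact hφ.contMDiffOn_symm.comp
      ((contMDiffOn_iff_contDiffOn.2 he).mono fun _ hz => hz.1) fun _ hz => hz.2

theorem IsChart.exists_normal (hφ : IsChart φ) (g : Metric n M) (hy : y ∈ φ.target) :
    ∃ φ' : OpenPartialHomeomorph M (Coord n), IsChart φ' ∧ ∃ z ∈ overlap φ φ',
      φ (φ'.symm z) = y ∧ IsNormalAt (localMetric g φ') z := by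
  have hG := hφ.isMetricOn g
  obtain ⟨P, hdet, hP⟩ := exists_transpose_mul_mul_eq_one (hG.posDef y hy)
  obtain ⟨e, h0, he, he'⟩ := hG.exists_openPartialHomeomorph_eq_normalMap hy hdet
  have he0 : e 0 = y := (congrFun he 0).trans quadraticMap_zero
  have hφ' : IsChart (φ.trans e.symm) :=
    hφ.trans_symm (he ▸ contDiff_quadraticMap.contDiffOn) he'
  have hmem : 0 ∈ overlap φ (φ.trans e.symm) := mem_overlap_trans_symm h0 (he0 ▸ hy)
  exact ⟨φ.trans e.symm, hφ', 0, hmem, (eqOn_transition_trans_symm hmem).trans he0,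
    (hφ.isIsometryOn g hφ').isNormalAt_of_eqOn_normalMap hy hP hmem
      (he ▸ eqOn_transition_trans_symm)⟩

end NormalChart

/-! ### Gradient solitons on compact manifolds -/

section Congruence

lemma laplacian_congr (hs : IsOpen s) (h : Set.EqOn u v s) (hy : y ∈ s) :
    laplacian G u y = laplacian G v y := by
  have hpd : ∀ i, Set.EqOn (pd i u) (pd i v) s := fun i _ hz => pd_congr hs h hz i
  simp only [laplacian, hessian, fun i => hpd i hy, fun i j => pd_congr hs (hpd j) hy i]

lemma gradSq_congr (hs : IsOpen s) (h : Set.EqOn u v s) (hy : y ∈ s) :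
    gradSq G u y = gradSq G v y := by
  simp only [gradSq, fun i => pd_congr hs h hy i]

lemma laplacian_neg : laplacian G (fun z => - u z) y = - laplacian G u y := by
  have hpd : ∀ i, pd i (fun z => - u z) = fun z => - pd i u z := fun i => funext fun _ => pd_neg i
  simp only [laplacian, hessian, hpd, pd_neg, ← Finset.sum_neg_distrib]
  refine Finset.sum_congr rfl fun i _ => Finset.sum_congr rfl fun j _ => ?_
  simp only [mul_neg, Finset.sum_neg_distrib]
  ring

lemma gradSq_neg : gradSq G (fun z => - u z) y = gradSq G u y := by
  simp only [gradSq, pd_neg, neg_mul_neg]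

lemma hessian_const (c : ℝ) (i j : Fin n) : hessian G (fun _ => c) i j y = 0 := by
  have hpd : pd j (fun _ : Coord n => c) = fun _ => 0 := funext fun _ => pd_const j c
  simp [hessian, hpd, pd_const]

lemma laplacian_const (c : ℝ) : laplacian G (fun _ => c) y = 0 := by
  simp [laplacian, hessian_const]

lemma gradSq_const (c : ℝ) : gradSq G (fun _ => c) y = 0 := by
  simp [gradSq, pd_const]

lemma gradInterior_const (c : ℝ) (i j : Fin n) : gradInterior G τ (fun _ => c) i j y = 0 := by
  simp [gradInterior, pd_const]

end Congruence

section Manifold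

variable {M : Type*} [TopologicalSpace M]

lemma comp_symm_eq_const {f : M → ℝ} {c : ℝ} (hc : ∀ x, f x = c)
    (φ : OpenPartialHomeomorph M (Coord n)) : f ∘ φ.symm = fun _ => c :=
  funext fun _ => hc _

variable [ChartedSpace (Coord n) M] [IsManifold (𝓡 n) ∞ M]
  {g : Metric n M} {T : ThreeForm n M} {f : M → ℝ} {φ φ' : OpenPartialHomeomorph M (Coord n)}
  {z : Coord n}

lemma isChart_chartAt (x : M) : IsChart (chartAt (Coord n) x) :=
  IsManifold.chart_mem_maximalAtlas x

/-- The function `Δf - |∇f|² + ⅙ ‖T‖²` in a chart. -/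
def localPotential (g : Metric n M) (T : ThreeForm n M) (f : M → ℝ)
    (φ : OpenPartialHomeomorph M (Coord n)) : Coord n → ℝ :=
  solitonPotential (localMetric g φ) (components T φ) (f ∘ φ.symm)

/-- The function `Δf - |∇f|² + ⅙ ‖T‖²` on `M`, evaluated at each point in the preferred chart. -/
def globalPotential (g : Metric n M) (T : ThreeForm n M) (f : M → ℝ) (x : M) : ℝ :=
  localPotential g T f (chartAt (Coord n) x) (chartAt (Coord n) x x)

namespace IsChart

lemma localPotential_transition (hφ : IsChart φ) (hφ' : IsChart φ')
    (hf : ContMDiff (𝓡 n) 𝓘(ℝ, ℝ) ∞ f) (hz : z ∈ overlap φ φ') :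
    localPotential g T f φ' z = localPotential g T f φ (φ (φ'.symm z)) := by
  have hcongr : Set.EqOn (f ∘ φ'.symm) (fun w => (f ∘ φ.symm) (φ (φ'.symm w))) (overlap φ φ') :=
    fun w hw => congrArg f (φ.left_inv hw.2).symm
  have hopen := isOpen_overlap φ φ'
  unfold localPotential
  rw [← (hφ.isIsometryOn g hφ').solitonPotential_comp hz (hφ.components_transition hφ' T hz)
    (contDiffOn_comp_symm hf hφ), solitonPotential, solitonPotential,
    laplacian_congr hopen hcongr hz, gradSq_congr hopen hcongr hz]

lemma localPotential_eq_globalPotential (hφ : IsChart φ) (hf : ContMDiff (𝓡 n) 𝓘(ℝ, ℝ) ∞ f)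
    (hy : y ∈ φ.target) : localPotential g T f φ y = globalPotential g T f (φ.symm y) :=
  (isChart_chartAt _).localPotential_transition hφ hf ⟨hy, mem_chart_source (Coord n) (φ.symm y)⟩

lemma contDiffOn_localPotential (hφ : IsChart φ) (g : Metric n M) (hT : IsSmooth T)
    (hf : ContMDiff (𝓡 n) 𝓘(ℝ, ℝ) ∞ f) : ContDiffOn ℝ ∞ (localPotential g T f φ) φ.target :=
  have hG := hφ.isMetricOn g
  have hfφ := contDiffOn_comp_symm hf hφ
  ((hG.contDiffOn_laplacian hfφ).sub (hG.contDiffOn_gradSq hfφ)).add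
    (contDiffOn_const.mul (hG.contDiffOn_normSq (hT.contDiffOn_components hφ)))

end IsChart

namespace IsGradientSoliton

variable (hsol : IsGradientSoliton g T f) (hT : IsSmooth T) (hf : ContMDiff (𝓡 n) 𝓘(ℝ, ℝ) ∞ f)
include hsol hT hf

lemma pd_localPotential (hφ : IsChart φ) (hy : y ∈ φ.target) (j : Fin n) :
    pd j (localPotential g T f φ) y = 0 := by
  obtain ⟨φ', hφ', z, hz, hzy, hN⟩ := hφ.exists_normal g hy
  have hcrit : ∀ a, pd a (localPotential g T f φ') z = 0 :=
    (hφ'.isSolitonOn g hT hf hsol).pd_solitonPotential hz.1 hN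
  have hy' : y ∈ overlap φ' φ := hzy ▸ overlap_swap_mem hz
  have hback : φ' (φ.symm y) = z := by rw [← hzy, φ.left_inv hz.2, φ'.right_inv hz.1]
  rw [pd_congr (isOpen_overlap φ' φ)
      (fun w hw => hφ'.localPotential_transition hφ hf hw) hy',
    (hφ'.isIsometryOn g hφ).pd_comp hy' (hφ'.contDiffOn_localPotential g hT hf)]
  simp [hback, hcrit]

lemma eventually_localPotential_eq (hφ : IsChart φ) (hy : y ∈ φ.target) :
    ∀ᶠ w in 𝓝 y, localPotential g T f φ w = localPotential g T f φ y := by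
  obtain ⟨r, hr0, hr⟩ := Metric.isOpen_iff.1 φ.open_target y hy
  filter_upwards [Metric.ball_mem_nhds y hr0] with w hw
  refine Metric.isOpen_ball.is_const_of_fderiv_eq_zero (𝕜 := ℝ)
    (convex_ball y r).isPreconnected
    (((hφ.contDiffOn_localPotential g hT hf).mono hr).differentiableOn (by simp))
    (fun v hv => ?_) hw (Metric.mem_ball_self hr0)
  ext d
  simp [fderiv_eq_sum_pd, hsol.pd_localPotential hT hf hφ (hr hv)]

lemma isLocallyConstant_globalPotential : IsLocallyConstant (globalPotential g T f) := by
  refine IsLocallyConstant.iff_eventually_eq _ |>.2 fun x => ?_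
  have hφ : IsChart (chartAt (Coord n) x) := isChart_chartAt x
  have hx := mem_chart_source (Coord n) x
  filter_upwards [(chartAt (Coord n) x).continuousAt hx
    (hsol.eventually_localPotential_eq hT hf hφ ((chartAt (Coord n) x).map_source hx)),
    (chartAt (Coord n) x).open_source.mem_nhds hx] with x' hx' hs'
  rw [Set.mem_preimage, Set.mem_ofPred_eq,
    hφ.localPotential_eq_globalPotential hf (OpenPartialHomeomorph.map_source _ hs'),
    OpenPartialHomeomorph.left_inv _ hs'] at hx'
  exact hx'

theorem exists_localPotential_eq [ConnectedSpace M] :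
    ∃ l : ℝ, ∀ φ : OpenPartialHomeomorph M (Coord n), IsChart φ → ∀ y ∈ φ.target,
      localPotential g T f φ y = l := by
  obtain ⟨x₀⟩ := (inferInstance : Nonempty M)
  exact ⟨globalPotential g T f x₀, fun φ hφ y hy =>
    (hφ.localPotential_eq_globalPotential hf hy).trans <|
      (hsol.isLocallyConstant_globalPotential hT hf).apply_eq_of_preconnectedSpace _ _⟩

end IsGradientSoliton

/-- The equation `Δf - β |∇f|² = k` on a Riemannian manifold, stated in all charts. Each of the
conditions on a gradient soliton considered here implies an equation of this kind. -/
def IsLaplaceGradientSolution (g : Metric n M) (β k : ℝ) (f : M → ℝ) : Prop :=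
  ∀ φ : OpenPartialHomeomorph M (Coord n), IsChart φ → ∀ y ∈ φ.target,
    laplacian (localMetric g φ) (f ∘ φ.symm) y
      = β * gradSq (localMetric g φ) (f ∘ φ.symm) y + k

namespace IsLaplaceGradientSolution

variable {β k : ℝ}

lemma neg (h : IsLaplaceGradientSolution g β k f) :
    IsLaplaceGradientSolution g (-β) (-k) fun x => - f x := fun φ hφ y hy => by
  have hlap := laplacian_neg (G := localMetric g φ) (u := f ∘ φ.symm) (y := y)
  have hgrad := gradSq_neg (G := localMetric g φ) (u := f ∘ φ.symm) (y := y)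
  rw [h φ hφ y hy] at hlap
  refine hlap.trans ?_
  rw [← hgrad]
  ring_nf
  rfl

lemma nonpos_of_isMax (h : IsLaplaceGradientSolution g β k f)
    (hf : ContMDiff (𝓡 n) 𝓘(ℝ, ℝ) ∞ f) {x : M} (hmax : ∀ x', f x' ≤ f x) : k ≤ 0 := by
  set φ := chartAt (Coord n) x
  have hφ : IsChart φ := isChart_chartAt x
  have hx : x ∈ φ.source := mem_chart_source (Coord n) x
  have hlocal : IsLocalMax (f ∘ φ.symm) (φ x) := .of_forall fun w => by
    simpa [φ.left_inv hx] using hmax (φ.symm w)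
  have hle := ellipticOp_nonpos_of_isLocalMax
    (A := fun z => (localMetric g φ z)⁻¹)
    (b := gradientDrift (localMetric g φ) β (f ∘ φ.symm)) φ.open_target
    (contDiffOn_comp_symm hf hφ) (φ.map_source hx) hlocal
    ((hφ.isMetricOn g).posDef _ (φ.map_source hx)).inv.posSemidef
  rw [ellipticOp_gradientDrift, h φ hφ _ (φ.map_source hx)] at hle
  linarith

lemma eventually_eq_of_isMax (h : IsLaplaceGradientSolution g β 0 f)
    (hf : ContMDiff (𝓡 n) 𝓘(ℝ, ℝ) ∞ f) {x : M} (hmax : ∀ x', f x' ≤ f x) :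
    ∀ᶠ x' in 𝓝 x, f x' = f x := by
  set φ := chartAt (Coord n) x
  have hφ : IsChart φ := isChart_chartAt x
  have hx : x ∈ φ.source := mem_chart_source (Coord n) x
  have hval : (f ∘ φ.symm) (φ x) = f x := congrArg f (φ.left_inv hx)
  have hconst := (hφ.isMetricOn g).eventually_eq_of_isMax (contDiffOn_comp_symm hf hφ)
    (fun z hz => (h φ hφ z hz).trans (add_zero _)) (φ.map_source hx)
    fun z _ => (hmax _).trans_eq hval.symm
  filter_upwards [φ.continuousAt hx hconst, φ.open_source.mem_nhds hx] with x' hx' hs'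
  rw [← hval, ← show _ = _ from hx', Function.comp_apply, φ.left_inv hs']

theorem exists_eq_const [CompactSpace M] [ConnectedSpace M]
    (h : IsLaplaceGradientSolution g β k f) (hf : ContMDiff (𝓡 n) 𝓘(ℝ, ℝ) ∞ f) :
    ∃ c : ℝ, ∀ x, f x = c := by
  have hcont : Continuous f := hf.continuous
  obtain ⟨p, -, hp⟩ := isCompact_univ.exists_isMaxOn Set.univ_nonempty hcont.continuousOn
  obtain ⟨q, -, hq⟩ := isCompact_univ.exists_isMinOn Set.univ_nonempty hcont.continuousOn
  have hmax : ∀ x, f x ≤ f p := fun x => hp (Set.mem_univ x)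
  have hk : k = 0 := le_antisymm (h.nonpos_of_isMax hf hmax) <| neg_nonpos.1 <|
    h.neg.nonpos_of_isMax hf.neg fun x => neg_le_neg (hq (Set.mem_univ x))
  subst hk
  have hclopen : IsClopen {x | f x = f p} :=
    ⟨isClosed_eq hcont continuous_const, isOpen_iff_mem_nhds.2 fun x (hx : f x = f p) => by
      filter_upwards [h.eventually_eq_of_isMax hf fun x' => (hmax x').trans_eq hx.symm]
        with x' hx' using hx'.trans hx⟩
  exact ⟨f p, fun x => Set.eq_univ_iff_forall.1 (hclopen.eq_univ ⟨p, rfl⟩) x⟩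

end IsLaplaceGradientSolution

namespace IsGradientSoliton

variable (hsol : IsGradientSoliton g T f) (hT : IsSmooth T) (hf : ContMDiff (𝓡 n) 𝓘(ℝ, ℝ) ∞ f)
include hsol hT hf

section Connected

variable [ConnectedSpace M]

lemma hasConstantNorm_of_const (hconst : ∃ c : ℝ, ∀ x, f x = c) : HasConstantNorm g T := by
  obtain ⟨l, hl⟩ := hsol.exists_localPotential_eq hT hf
  obtain ⟨c, hc⟩ := hconst
  refine ⟨6 * l, fun φ hφ y hy => ?_⟩
  have hP := hl φ hφ y hy
  rw [localPotential, solitonPotential, comp_symm_eq_const hc φ, laplacian_const,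
    gradSq_const] at hP
  linarith

lemma hasConstantScalarCurvature_of_const (hconst : ∃ c : ℝ, ∀ x, f x = c) :
    HasConstantScalarCurvature g := by
  obtain ⟨k, hk⟩ := hsol.hasConstantNorm_of_const hT hf hconst
  obtain ⟨c, hc⟩ := hconst
  refine ⟨(1 / 4) * k, fun φ hφ y hy => ?_⟩
  rw [(hφ.isSolitonOn g hT hf hsol).scalarCurvature_eq hy, hk φ hφ y hy, comp_symm_eq_const hc φ,
    laplacian_const, sub_zero]

variable [CompactSpace M]

theorem const_of_hasConstantNorm (h : HasConstantNorm g T) : ∃ c : ℝ, ∀ x, f x = c := by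
  obtain ⟨l, hl⟩ := hsol.exists_localPotential_eq hT hf
  obtain ⟨c, hc⟩ := h
  have heq : IsLaplaceGradientSolution g 1 (l - (1 / 6) * c) f := fun φ hφ y hy => by
    have hP := hl φ hφ y hy
    rw [localPotential, solitonPotential, hc φ hφ y hy] at hP
    linarith
  exact heq.exists_eq_const hf

theorem const_of_hasConstantScalarCurvature (h : HasConstantScalarCurvature g) :
    ∃ c : ℝ, ∀ x, f x = c := by
  obtain ⟨l, hl⟩ := hsol.exists_localPotential_eq hT hf
  obtain ⟨c, hc⟩ := h
  have heq : IsLaplaceGradientSolution g (3 / 5) ((3 / 5) * (l - (2 / 3) * c)) f :=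
    fun φ hφ y hy => by
      have hP := hl φ hφ y hy
      have hscal := (hφ.isSolitonOn g hT hf hsol).scalarCurvature_eq hy
      rw [hc φ hφ y hy] at hscal
      rw [localPotential, solitonPotential] at hP
      linarith
  exact heq.exists_eq_const hf

theorem const_of_isTorsionRicciFlat (h : IsTorsionRicciFlat g T) : ∃ c : ℝ, ∀ x, f x = c := by
  have heq : IsLaplaceGradientSolution g 0 0 f := fun φ hφ y hy => by
    rw [(hφ.isSolitonOn g hT hf hsol).laplacian_eq_zero_of_ricci_torsionCoeff hy (h φ hφ y hy),
      zero_mul, add_zero]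
  exact heq.exists_eq_const hf

end Connected

lemma isTorsionRicciFlat_of_const (hconst : ∃ c : ℝ, ∀ x, f x = c) : IsTorsionRicciFlat g T := by
  obtain ⟨c, hc⟩ := hconst
  intro φ hφ y hy i j
  rw [(hφ.isSolitonOn g hT hf hsol).ricci_torsionCoeff hy, comp_symm_eq_const hc φ, hessian_const,
    gradInterior_const, neg_zero, mul_zero, add_zero]

omit hT hf in
lemma isHarmonic_of_const (hconst : ∃ c : ℝ, ∀ x, f x = c) : IsHarmonic g T := by
  obtain ⟨c, hc⟩ := hconst
  refine ⟨hsol.closed, fun φ hφ y hy i j => ?_⟩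
  rw [hsol.codiff_eq φ hφ y hy, comp_symm_eq_const hc φ, gradInterior_const, neg_zero]

end IsGradientSoliton

end Manifold

end SkewTorsion

end

theorem theorem1p1_general {n : ℕ} {M : Type*} [TopologicalSpace M] [CompactSpace M]
    [ConnectedSpace M] [ChartedSpace (EuclideanSpace ℝ (Fin n)) M] [IsManifold (𝓡 n) ∞ M]
    (g : SkewTorsion.Metric n M) (T : SkewTorsion.ThreeForm n M) (hT : SkewTorsion.IsSmooth T)
    (f : M → ℝ) (hf : ContMDiff (𝓡 n) 𝓘(ℝ, ℝ) ∞ f)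
    (hsol : SkewTorsion.IsGradientSoliton g T f) :
    [SkewTorsion.HasConstantNorm g T,
      ∃ c : ℝ, ∀ x, f x = c,
      SkewTorsion.IsTorsionRicciFlat g T,
      SkewTorsion.HasConstantScalarCurvature g].TFAE ∧
    ((SkewTorsion.HasConstantNorm g T ∨ (∃ c : ℝ, ∀ x, f x = c) ∨
      SkewTorsion.IsTorsionRicciFlat g T ∨ SkewTorsion.HasConstantScalarCurvature g) →
      SkewTorsion.IsHarmonic g T) := by
  have hnorm := hsol.const_of_hasConstantNorm hT hf
  have hflat := hsol.const_of_isTorsionRicciFlat hT hf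
  have hscal := hsol.const_of_hasConstantScalarCurvature hT hf
  constructor
  · tfae_have 1 → 2 := hnorm
    tfae_have 2 → 1 := hsol.hasConstantNorm_of_const hT hf
    tfae_have 3 → 2 := hflat
    tfae_have 2 → 3 := hsol.isTorsionRicciFlat_of_const hT hf
    tfae_have 4 → 2 := hscal
    tfae_have 2 → 4 := hsol.hasConstantScalarCurvature_of_const hT hf
    tfae_finish
  · rintro (h | h | h | h)
    exacts [hsol.isHarmonic_of_const (hnorm h), hsol.isHarmonic_of_const h,
      hsol.isHarmonic_of_const (hflat h), hsol.isHarmonic_of_const (hscal h)]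

theorem theorem1p1 {n : ℕ} {M : Type*} [TopologicalSpace M] [T2Space M] [CompactSpace M]
    [ConnectedSpace M] [ChartedSpace (EuclideanSpace ℝ (Fin n)) M] [IsManifold (𝓡 n) ∞ M]
    (g : SkewTorsion.Metric n M) (T : SkewTorsion.ThreeForm n M) (hT : SkewTorsion.IsSmooth T)
    (f : M → ℝ) (hf : ContMDiff (𝓡 n) 𝓘(ℝ, ℝ) ∞ f)
    (hsol : SkewTorsion.IsGradientSoliton g T f) :
    [SkewTorsion.HasConstantNorm g T,
      ∃ c : ℝ, ∀ x, f x = c,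
      SkewTorsion.IsTorsionRicciFlat g T,
      SkewTorsion.HasConstantScalarCurvature g].TFAE ∧
    ((SkewTorsion.HasConstantNorm g T ∨ (∃ c : ℝ, ∀ x, f x = c) ∨
      SkewTorsion.IsTorsionRicciFlat g T ∨ SkewTorsion.HasConstantScalarCurvature g) →
      SkewTorsion.IsHarmonic g T) :=
  theorem1p1_general g T hT f hf hsol
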